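/- Notation. Let $1<p<\infty$ and let $X^p=X^p(\mathbb R_+)$ be the Banach space of (classes of a.e. equal) measurable functions $f:(0,\infty)\to\mathbb C$ with $\|f\|_{X^p}=\big(\int_0^\infty |f(x)|^p\,\frac{dx}{x}\big)^{1/p}<\infty$. For $t\in\mathbb R$ let $U(t)f(x)=f(e^tx)$; this is a group of isometries of $X^p$. Let $\Theta=x\frac{d}{dx}$ be its infinitesimal generator, $\Theta f=\frac{d}{dt}U(t)f\big|_{t=0}$ (derivative in the norm of $X^p$), let $\mathcal D^k(\Theta)$ be the domain of the $k$-th power $\Theta^k$, and for $\sigma>0$ let $$\mathbf B_\sigma^p(\Theta)=\Big\{f\in\bigcap_k\mathcal D^k(\Theta):\ \|\Theta^kf\|_{X^p}\le\sigma^k\|f\|_{X^p}\text{ for all }k\in\mathbb N\Big\}.$$ For $m\ge1$, $k\in\mathbb Z$ put $$A_{m,k}=\frac{(2m-1)!}{\pi(k-\frac12)^{2m}}\sum_{j=0}^{m-1}\frac{(-1)^j}{(2j)!}\big(\pi(k-\tfrac12)\big)^{2j},\qquad B_{m,0}=(-1)^{m+1}\frac{\pi^{2m}}{2m+1},$$ $$B_{m,k}=\frac{(2m)!}{\pi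 k^{2m+1}}\sum_{j=0}^{m-1}\frac{(-1)^j(\pi k)^{2j+1}}{(2j+1)!}\quad(k\neq0),$$ and define the Riesz–Boas operators on $X^p$ by $$\mathcal R^{(2m-1)}(\sigma)f(x)=\Big(\frac\sigma\pi\Big)^{2m-1}\sum_{k\in\mathbb Z}(-1)^{k+1}A_{m,k}\,f\big(e^{\frac\pi\sigma(k-\frac12)}x\big),\qquad \mathcal R^{(2m)}(\sigma)f(x)=\Big(\frac\sigma\pi\Big)^{2m}\sum_{k\in\mathbb Z}(-1)^{k+1}B_{m,k}\,f\big(e^{\frac{\pi k}\sigma}x\big),$$ the series being taken in $X^p$. Write $\mathcal R(\sigma)=\mathcal R^{(1)}(\sigma)$ and $\mathcal R^r(\sigma)=\mathcal R(\sigma)\circ\cdots\circ\mathcal R(\sigma)$ ($r$ factors). Statement. Let $1<p<\infty$ and $\sigma>0$. The series defining $\mathcal R^{(r)}(\sigma)g$ converges unconditionally in $X^p$ for every $g\in X^p$ and every integer $r\ge1$. The operator $\mathcal R(\sigma)$ maps $\mathbf B_\sigma^p(\Theta)$ into itself and commutes with $\Theta$ there: $\Theta\,\mathcal R(\sigma)f=\mathcal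 R(\sigma)\,\Theta f$ for $f\in\mathbf B_\sigma^p(\Theta)$. Moreover, for every $f\in\mathbf B_\sigma^p(\Theta)$ and every integer $r\ge1$, $$\Theta^rf=\mathcal R^{(r)}(\sigma)f=\mathcal R^r(\sigma)f .$$ -/

import Mathlib

open MeasureTheory Set Filter Topology
open scoped ENNReal Nat

noncomputable section

namespace Mellin

/-- The measure `dx / x` on `ℝ₊ = (0, ∞)`. -/
def haar : Measure ℝ :=
  (volume.restrict (Ioi 0)).withDensity (fun x => ENNReal.ofReal x⁻¹)

/-- The space `X^p(ℝ₊)`: (classes of a.e. equal) measurable functions `f` on `ℝ₊` such that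
`x ↦ f x * x ^ (-1/p)` is in `L^p(ℝ₊, dx)`, i.e. such that `f` is in `L^p(ℝ₊, dx/x)`;
see `eLpNorm_haar`. -/
abbrev X (p : ℝ≥0∞) : Type := Lp ℂ p haar

/-- The `L^p(dx/x)`-norm of `f` is the norm `‖f(·)(·)^{-1/p}‖_{L^p(ℝ₊, dx)}`. -/
theorem eLpNorm_haar (p : ℝ≥0∞) (h0 : p ≠ 0) (hp : p ≠ ∞) (f : ℝ → ℂ) :
    eLpNorm f p haar =
      eLpNorm (fun x => f x * ((x ^ (-1 / p.toReal) : ℝ) : ℂ)) p (volume.restrict (Ioi 0)) := by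
  have hpos : 0 < p.toReal := ENNReal.toReal_pos h0 hp
  rw [eLpNorm_eq_lintegral_rpow_enorm_toReal h0 hp, eLpNorm_eq_lintegral_rpow_enorm_toReal h0 hp]
  congr 1
  rw [haar, lintegral_withDensity_eq_lintegral_mul_non_measurable _ (by fun_prop)
    (ae_of_all _ fun x => ENNReal.ofReal_lt_top)]
  refine setLIntegral_congr_fun measurableSet_Ioi fun x hx => ?_
  have hx0 : (0 : ℝ) < x := hx
  have h1 : ‖((x ^ (-1 / p.toReal) : ℝ) : ℂ)‖ₑ = ENNReal.ofReal (x ^ (-1 / p.toReal)) := by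
    rw [← ofReal_norm, Complex.norm_real, Real.norm_of_nonneg (by positivity)]
  simp only [Pi.mul_apply, enorm_mul, h1]
  rw [ENNReal.mul_rpow_of_nonneg _ _ hpos.le,
    ENNReal.ofReal_rpow_of_nonneg (by positivity) hpos.le, ← Real.rpow_mul hx0.le,
    div_mul_cancel₀ _ hpos.ne', Real.rpow_neg_one, mul_comm]

/-- Dilations preserve `dx / x`. -/
theorem measurePreserving_dilation (t : ℝ) :
    MeasurePreserving (fun x : ℝ => Real.exp t * x) haar haar := by
  have hm : Measurable (fun x : ℝ => Real.exp t * x) := by fun_prop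
  refine ⟨hm, Measure.ext fun s hs => ?_⟩
  have hc : 0 < Real.exp t := Real.exp_pos t
  set G : ℝ → ℝ≥0∞ := (s ∩ Ioi 0).indicator (fun x => ENNReal.ofReal x⁻¹) with hG
  have hGm : Measurable G :=
    Measurable.indicator (by fun_prop) (hs.inter measurableSet_Ioi)
  have e1 : ∀ u : Set ℝ, MeasurableSet u →
      haar u = ∫⁻ x, (u ∩ Ioi 0).indicator (fun x => ENNReal.ofReal x⁻¹) x := by
    intro u hu
    rw [haar, withDensity_apply _ hu, Measure.restrict_restrict hu,
      lintegral_indicator (hu.inter measurableSet_Ioi)]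
  rw [Measure.map_apply hm hs, e1 _ (hm hs), e1 _ hs]
  have e2 : ∀ x : ℝ, (((fun x : ℝ => Real.exp t * x) ⁻¹' s) ∩ Ioi 0).indicator
      (fun x => ENNReal.ofReal x⁻¹) x = ENNReal.ofReal (Real.exp t) * G (Real.exp t * x) := by
    intro x
    have hiff : x ∈ ((fun x : ℝ => Real.exp t * x) ⁻¹' s) ∩ Ioi 0 ↔
        Real.exp t * x ∈ s ∩ Ioi 0 := by
      simp [hc]
    by_cases hx : Real.exp t * x ∈ s ∩ Ioi 0
    · rw [indicator_of_mem (hiff.2 hx), hG, indicator_of_mem hx, ← ENNReal.ofReal_mul hc.le,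
        mul_inv, mul_inv_cancel_left₀ hc.ne']
    · rw [indicator_of_notMem (fun h => hx (hiff.1 h)), hG, indicator_of_notMem hx, mul_zero]
  simp_rw [e2]
  have e3 : ∫⁻ x, ENNReal.ofReal (Real.exp t) * G (Real.exp t * x) =
      ENNReal.ofReal (Real.exp t) * ∫⁻ x, G (Real.exp t * x) :=
    lintegral_const_mul _ (hGm.comp hm)
  have e4 : ∫⁻ x, G (Real.exp t * x) =
      ∫⁻ x, G x ∂(Measure.map (fun x : ℝ => Real.exp t * x) volume) :=
    (lintegral_map hGm hm).symm
  rw [e3, e4,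
    Real.map_volume_mul_left hc.ne', lintegral_smul_measure, smul_eq_mul, ← mul_assoc,
    ← ENNReal.ofReal_mul hc.le, abs_of_pos (inv_pos.2 hc), mul_inv_cancel₀ hc.ne',
    ENNReal.ofReal_one, one_mul]

variable (p : ℝ≥0∞) [Fact (1 ≤ p)]

/-- The group of Mellin translations, `U(t) f (x) = f (e^t x)`, on `X^p(ℝ₊)`. -/
def U (t : ℝ) : X p →ₗᵢ[ℂ] X p :=
  Lp.compMeasurePreservingₗᵢ ℂ (fun x : ℝ => Real.exp t * x) (measurePreserving_dilation t)

/-- The domain of the infinitesimal generator of the group `U`: all `f` for which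
`t ↦ U(t) f` is differentiable at `0`, with respect to the norm of `X^p(ℝ₊)`. -/
def InDomain (f : X p) : Prop := DifferentiableAt ℝ (fun t : ℝ => U p t f) 0

/-- The infinitesimal generator `Θ = x d/dx`, `Θ f = d/dt U(t) f |_{t = 0}`
(meaningful for `f` in its domain). -/
def Theta (f : X p) : X p := deriv (fun t : ℝ => U p t f) 0

/-- The domain `𝒟^k(Θ)` of the power `Θ^k`. -/
def powDomain : ℕ → Set (X p)
  | 0 => univ
  | k + 1 => {f | InDomain p f ∧ Theta p f ∈ powDomain k}

/-- The Bernstein space `B_σ^p(Θ)`. -/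
def Bernstein (σ : ℝ) : Set (X p) :=
  {f | (∀ k : ℕ, f ∈ powDomain p k) ∧ ∀ k : ℕ, ‖(Theta p)^[k] f‖ ≤ σ ^ k * ‖f‖}

/-- `A_{m,k} = (-1)^(k+1) sinc^(2m-1) (1/2 - k)`, for `m ≥ 1`. -/
def A (m : ℕ) (k : ℤ) : ℝ :=
  ((2 * m - 1)! : ℝ) / (Real.pi * ((k : ℝ) - 1 / 2) ^ (2 * m)) *
    ∑ j ∈ Finset.range m,
      (-1 : ℝ) ^ j / ((2 * j)! : ℝ) * (Real.pi * ((k : ℝ) - 1 / 2)) ^ (2 * j)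

/-- `B_{m,k} = (-1)^(k+1) sinc^(2m) (-k)`, for `m ≥ 1`. -/
def B (m : ℕ) (k : ℤ) : ℝ :=
  if k = 0 then (-1 : ℝ) ^ (m + 1) * (Real.pi ^ (2 * m) / (2 * (m : ℝ) + 1))
  else ((2 * m)! : ℝ) / (Real.pi * (k : ℝ) ^ (2 * m + 1)) *
    ∑ j ∈ Finset.range m,
      (-1 : ℝ) ^ j * (Real.pi * (k : ℝ)) ^ (2 * j + 1) / ((2 * j + 1)! : ℝ)

/-- The `k`-th term of the series defining the Riesz–Boas operator of order `r ≥ 1`: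
`r = 2m` in the first case and `r = 2m - 1` in the second. -/
def rieszBoasTerm (r : ℕ) (σ : ℝ) (f : X p) (k : ℤ) : X p :=
  if Even r then
    ((-1 : ℝ) ^ (k + 1) * B (r / 2) k) • U p (Real.pi * (k : ℝ) / σ) f
  else
    ((-1 : ℝ) ^ (k + 1) * A ((r + 1) / 2) k) • U p (Real.pi / σ * ((k : ℝ) - 1 / 2)) f

/-- The Riesz–Boas operator `ℛ^(r)(σ)` on `X^p(ℝ₊)`, `r ≥ 1`; the series is taken in the norm
of `X^p(ℝ₊)`. -/
def rieszBoas (r : ℕ) (σ : ℝ) (f : X p) : X p :=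
  (σ / Real.pi) ^ r • ∑' k : ℤ, rieszBoasTerm p r σ f k

end Mellin

end

/-! For `f` in the Bernstein space the curves `h n t = σ⁻¹ ^ n • U(t/σ) Θ^n f` satisfy `(h n)' = h
(n + 1)` and are all bounded by `‖f‖`. The Taylor series of `h 0` therefore converges to an entire
vector-valued `G` with `‖G z‖ ≤ M e^{|Im z|}` (`exists_entire_extension`), and `Θ^r f` is `σ^r`
times the `r`-th derivative of `G` at `0`.

That derivative is computed by residues. Take `S = cos` for odd `r` and `S = sin` for even `r`, let
`T` be the Taylor polynomial of `S` of degree `r - 1`, and integrate `T / (z^(r+1) S) • G` over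
large circles avoiding the zeros of `S`. There `|S|` dominates `e^{|Im z|}`, so the integrals tend
to `0`; the pole at `0` yields `G^(r)(0)/r!`, up to a multiple of `G 0` when `S = sin`, and the
zeros of `S` yield the samples of `G` weighted by `A` or `B`. As `deg T = r - 1`, the weights are
`O(k⁻²)`, so the series converges absolutely. Hence `Θ^r f = ℛ^(r)(σ) f`
(`theta_iterate_eq_rieszBoas`).

The identity with powers of `ℛ(σ)` requires that `Θ` preserve the Bernstein space, whose bounds for
`Θ f` are relative to `‖Θ f‖`, not `‖f‖`. This follows from Bernstein's inequality
(`norm_theta_le`): `∑ |A 1 k| = π` (`hasSum_abs_A_one`), so the formula with `r = 1` gives `‖Θ g‖ ≤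
σ ‖g‖` whenever `‖Θ^n g‖ ≤ σ^n M` for some `M`, whatever its size. -/

/-! ### Residue calculus for Banach-valued functions. -/

section Residues

variable {E : Type*} [NormedAddCommGroup E] [NormedSpace ℂ E] [CompleteSpace E]

/-- Removable singularities at finitely many points. -/
theorem exists_differentiableOn_eq_off_finset (Z : Finset ℂ) {V : Set ℂ} (hV : IsOpen V)
    (hZ : (Z : Set ℂ) ⊆ V) {H : ℂ → E} (hH : DifferentiableOn ℂ H (V \ Z))
    (hlim : ∀ ζ ∈ Z, Tendsto (fun z => (z - ζ) • H z) (𝓝[≠] ζ) (𝓝 0)) :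
    ∃ K : ℂ → E, DifferentiableOn ℂ K V ∧ ∀ z ∉ Z, K z = H z := by
  classical
  induction Z using Finset.induction_on generalizing H with
  | empty => exact ⟨H, by simpa using hH, fun _ _ => rfl⟩
  | insert c Z hc ih =>
    have hcV : c ∈ V := hZ (by simp)
    have hVZ : IsOpen (V \ (Z : Set ℂ)) := hV.sdiff Z.finite_toSet.isClosed
    have hcVZ : V \ (Z : Set ℂ) ∈ 𝓝 c := hVZ.mem_nhds ⟨hcV, by simpa using hc⟩
    have hd : DifferentiableOn ℂ H ((V \ (Z : Set ℂ)) \ {c}) := by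
      refine hH.mono fun z hz => ⟨hz.1.1, ?_⟩
      simpa [not_or] using ⟨hz.2, hz.1.2⟩
    have ho : (fun z => H z - H c) =o[𝓝[≠] c] fun z => (z - c)⁻¹ := by
      have hne : ∀ᶠ z in 𝓝[≠] c, z - c ≠ 0 := by
        filter_upwards [self_mem_nhdsWithin] with z hz using sub_ne_zero.2 hz
      have h1 : Tendsto (fun z => (z - c) • (H z - H c)) (𝓝[≠] c) (𝓝 0) := by
        have h2 : Tendsto (fun z => (z - c) • H c) (𝓝[≠] c) (𝓝 0) := by
          have : Continuous fun z : ℂ => (z - c) • H c := by fun_prop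
          simpa using (this.tendsto c).mono_left nhdsWithin_le_nhds
        simpa [smul_sub] using (hlim c (by simp)).sub h2
      rw [Asymptotics.isLittleO_iff]
      intro ε hε
      filter_upwards [hne, (tendsto_zero_iff_norm_tendsto_zero.1 h1).eventually (Iio_mem_nhds hε)]
        with z hz hlt
      rw [norm_smul] at hlt
      rw [norm_inv, ← div_eq_mul_inv, le_div_iff₀ (norm_pos_iff.2 hz), mul_comm]
      exact (show _ < ε from hlt).le
    have hK := Complex.differentiableOn_update_limUnder_of_isLittleO hcVZ hd ho
    obtain ⟨K, hK1, hK2⟩ := ih (fun z hz => hZ (by simp [Finset.mem_coe.1 hz])) hK (by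
      intro ζ hζ
      have hne : ζ ≠ c := fun h => hc (h ▸ hζ)
      refine (hlim ζ (by simp [hζ])).congr' ?_
      have : ∀ᶠ z in 𝓝[≠] ζ, z ≠ c := nhdsWithin_le_nhds (isOpen_ne.mem_nhds hne)
      filter_upwards [this] with z hz
      rw [Function.update_of_ne hz])
    refine ⟨K, hK1, fun z hz => ?_⟩
    simp only [Finset.mem_insert, not_or] at hz
    rw [hK2 z hz.2, Function.update_of_ne hz.1]

/-- The residue theorem on a disc, for a function with finitely many simple poles. -/
theorem circleIntegral_eq_sum_of_simple_poles {c : ℂ} {R : ℝ} (hR : 0 < R) {V : Set ℂ}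
    (hV : IsOpen V) (hcV : Metric.closedBall c R ⊆ V) (Z : Finset ℂ)
    (hZ : (Z : Set ℂ) ⊆ Metric.ball c R) {h : ℂ → E} (hh : DifferentiableOn ℂ h (V \ Z))
    (a : ℂ → E) (hlim : ∀ ζ ∈ Z, Tendsto (fun z => (z - ζ) • h z) (𝓝[≠] ζ) (𝓝 (a ζ))) :
    (∮ z in C(c, R), h z) = (2 * Real.pi * Complex.I) • ∑ ζ ∈ Z, a ζ := by
  classical
  have hZs : ∀ ζ ∈ Z, ∀ z ∈ Metric.sphere c R, z - ζ ≠ 0 := by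
    intro ζ hζ z hz h0
    have h1 := hZ (Finset.mem_coe.2 hζ)
    rw [← sub_eq_zero.1 h0, Metric.mem_ball, Metric.mem_sphere.1 hz] at h1
    exact lt_irrefl _ h1
  have hsd : ∀ ζ ∈ Z, ∀ z ≠ ζ, DifferentiableAt ℂ (fun z => (z - ζ)⁻¹ • a ζ) z := by
    intro ζ _ z hz
    have : z - ζ ≠ 0 := sub_ne_zero.2 hz
    fun_prop (disch := assumption)
  -- Subtracting all the principal parts leaves only removable singularities, so Cauchy's theorem
  -- applies to the extension `K`.
  obtain ⟨K, hK1, hK2⟩ := exists_differentiableOn_eq_off_finset Z hV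
    (H := fun z => h z - ∑ ζ ∈ Z, (z - ζ)⁻¹ • a ζ)
    ((hZ.trans Metric.ball_subset_closedBall).trans hcV)
    (hh.sub (DifferentiableOn.fun_sum fun ζ hζ z hz =>
      (hsd ζ hζ z fun h => hz.2 (h ▸ hζ)).differentiableWithinAt)) (by
    intro ζ hζ
    have h1 : Tendsto (fun z => (z - ζ) • ∑ ξ ∈ Z.erase ζ, (z - ξ)⁻¹ • a ξ) (𝓝[≠] ζ) (𝓝 0) := by
      have : ContinuousAt (fun z => (z - ζ) • ∑ ξ ∈ Z.erase ζ, (z - ξ)⁻¹ • a ξ) ζ := by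
        refine ContinuousAt.smul (by fun_prop) (tendsto_finsetSum _ fun ξ hξ => ?_)
        exact (hsd ξ (Finset.mem_of_mem_erase hξ) ζ (Finset.ne_of_mem_erase hξ).symm).continuousAt
      simpa using this.tendsto.mono_left nhdsWithin_le_nhds
    have h2 := ((hlim ζ hζ).sub_const (a ζ)).sub h1
    rw [sub_self, sub_zero] at h2
    refine h2.congr' ?_
    filter_upwards [self_mem_nhdsWithin] with z hz
    have hz0 : z - ζ ≠ 0 := sub_ne_zero.2 hz
    rw [← Finset.add_sum_erase Z _ hζ, smul_sub, smul_add, smul_smul, mul_inv_cancel₀ hz0,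
      one_smul]
    abel)
  have hKi : (∮ z in C(c, R), K z) = 0 :=
    DiffContOnCl.circleIntegral_eq_zero hR.le (hK1.diffContOnCl_ball hcV)
  have hnZ : ∀ z ∈ Metric.sphere c R, z ∉ Z := fun z hz hzZ => hZs z hzZ z hz (sub_self z)
  have hi1 : CircleIntegrable h c R := by
    refine ContinuousOn.circleIntegrable hR.le (hh.continuousOn.mono fun z hz => ?_)
    exact ⟨hcV (Metric.sphere_subset_closedBall hz), hnZ z hz⟩
  have hi2 : ∀ ζ ∈ Z, CircleIntegrable (fun z => (z - ζ)⁻¹ • a ζ) c R := by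
    intro ζ hζ
    refine ContinuousOn.circleIntegrable hR.le fun z hz => ?_
    exact (hsd ζ hζ z fun h => hnZ z hz (h ▸ hζ)).continuousAt.continuousWithinAt
  rw [circleIntegral.integral_congr hR.le (fun z hz => hK2 z (hnZ z hz)),
    circleIntegral.integral_sub hi1 (CircleIntegrable.fun_sum _ hi2),
    circleIntegral.integral_fun_sum hi2, sub_eq_zero] at hKi
  rw [hKi, Finset.smul_sum]
  refine Finset.sum_congr rfl fun ζ hζ => ?_
  rw [circleIntegral.integral_smul_const, circleIntegral.integral_sub_inv_of_mem_ball (hZ hζ)]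

/-- Evaluation of a derivative at `0` of an entire function by the residues of
`T / (z ^ (r + 1) S) • G`, when this function is small on a sequence of circles. -/
theorem tendsto_sum_residues_of_quotient_bound {S T : ℂ → ℂ} (hS : Differentiable ℂ S)
    (hT : Differentiable ℂ T) {G : ℂ → E} (hG : Differentiable ℂ G) {M c C : ℝ}
    (hGM : ∀ z, ‖G z‖ ≤ M * Real.exp |z.im|) (r : ℕ)
    (hTC : ∀ z, 1 ≤ ‖z‖ → ‖z‖ * ‖T z‖ ≤ C * ‖z‖ ^ r)
    (R : ℕ → ℝ) (hR1 : ∀ N, 1 ≤ R N) (hR : Tendsto R atTop atTop)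
    (hSc : ∀ N z, ‖z‖ = R N → Real.exp |z.im| ≤ c * ‖S z‖)
    (Z : ℕ → Finset ℂ) (hZ0 : ∀ N, 0 ∈ Z N) (hZR : ∀ N, ∀ z ∈ Z N, ‖z‖ < R N)
    (hZS : ∀ N z, ‖z‖ < R N → S z = 0 → z ∈ Z N)
    (hZS' : ∀ N, ∀ z ∈ Z N, z ≠ 0 → S z = 0 ∧ deriv S z ≠ 0) (b : ℂ)
    (hb : Tendsto (fun z => z * ((S z - T z) / (z ^ (r + 1) * S z))) (𝓝[≠] 0) (𝓝 b)) :
    Tendsto (fun N => ∑ ζ ∈ Z N,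
        if ζ = 0 then b • G 0 else -(T ζ / (ζ ^ (r + 1) * deriv S ζ)) • G ζ)
      atTop (𝓝 ((r ! : ℂ)⁻¹ • iteratedDeriv r G 0)) := by
  have hpi : (2 * Real.pi * Complex.I : ℂ) ≠ 0 := Complex.two_pi_I_ne_zero
  have hM : 0 ≤ M := by simpa using (norm_nonneg _).trans (hGM 0)
  have hC : 0 ≤ C := by
    have := hTC 1 (by simp)
    simp at this
    exact (norm_nonneg _).trans this
  have hSne : ∀ N z, ‖z‖ = R N → S z ≠ 0 := by
    intro N z hz h0
    have := hSc N z hz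
    rw [h0, norm_zero, mul_zero] at this
    exact absurd this (not_le.2 (Real.exp_pos _))
  have hc : 0 ≤ c := by
    have h1 := hSc 0 (R 0 : ℂ) (by simp [abs_of_nonneg (zero_le_one.trans (hR1 0))])
    by_contra hneg
    have h2 := mul_nonpos_of_nonpos_of_nonneg (not_le.1 hneg).le (norm_nonneg (S (R 0 : ℂ)))
    exact absurd (h1.trans h2) (not_le.2 (Real.exp_pos _))
  -- Split `T / (z^(r+1) S) = 1 / z^(r+1) - (S - T) / (z^(r+1) S)`: the first term is Cauchy's
  -- formula for the `r`-th derivative, and the second has only simple poles, with residue at `0`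
  -- governed by `hb`.
  have key : ∀ N, (∮ z in C(0, R N), (T z / (z ^ (r + 1) * S z)) • G z) =
      (2 * Real.pi * Complex.I) • ((r ! : ℂ)⁻¹ • iteratedDeriv r G 0 - ∑ ζ ∈ Z N,
        if ζ = 0 then b • G 0 else -(T ζ / (ζ ^ (r + 1) * deriv S ζ)) • G ζ) := by
    intro N
    have hRN : 0 < R N := zero_lt_one.trans_le (hR1 N)
    have hz0 : ∀ z ∈ Metric.sphere (0 : ℂ) (R N), z ≠ 0 := by
      rintro z hz rfl
      simp at hz
      exact hRN.ne hz
    have e1 := DiffContOnCl.circleIntegral_one_div_sub_center_pow_smul (c := 0) hRN r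
      hG.diffContOnCl
    -- An open neighbourhood of the closed disc containing no zeros of `S` outside the open disc.
    have hVo : IsOpen ({z | S z ≠ 0} ∪ Metric.ball 0 (R N)) :=
      (isOpen_ne.preimage hS.continuous).union Metric.isOpen_ball
    have hd : DifferentiableOn ℂ (fun z => ((S z - T z) / (z ^ (r + 1) * S z)) • G z)
        (({z | S z ≠ 0} ∪ Metric.ball 0 (R N)) \ Z N) := by
      rintro z ⟨hz, hzZ⟩
      have hSz : S z ≠ 0 := by
        rcases hz with hz | hz
        · exact hz
        · exact fun h => hzZ (hZS N z (by simpa using hz) h)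
      have hz0 : z ≠ 0 := fun h => hzZ (by rw [h]; exact hZ0 N)
      have : z ^ (r + 1) * S z ≠ 0 := mul_ne_zero (pow_ne_zero _ hz0) hSz
      have h1 := hS z
      have h2 := hT z
      have h3 := hG z
      exact DifferentiableAt.differentiableWithinAt (by fun_prop (disch := assumption))
    have e2 := circleIntegral_eq_sum_of_simple_poles hRN hVo (fun z hz => by
        rcases (mem_closedBall_zero_iff.1 hz).lt_or_eq with h | h
        · exact Or.inr (by simpa using h)
        · exact Or.inl (hSne N z h)) (Z N) (fun z hz => by simpa using hZR N z hz) hd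
      (fun ζ => if ζ = 0 then b • G 0 else -(T ζ / (ζ ^ (r + 1) * deriv S ζ)) • G ζ) (by
        intro ζ hζ
        by_cases h0 : ζ = 0
        · subst h0
          simp only [if_true, sub_zero]
          have := hb.smul (hG.continuous.tendsto 0 |>.mono_left
            (nhdsWithin_le_nhds (s := {(0 : ℂ)}ᶜ)))
          simpa only [smul_smul] using this
        · rw [if_neg h0]
          obtain ⟨hζS, hζS'⟩ := hZS' N ζ hζ h0
          have hslope : Tendsto (fun z => S z / (z - ζ)) (𝓝[≠] ζ) (𝓝 (deriv S ζ)) := by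
            have := (hS ζ).hasDerivAt.tendsto_slope
            refine this.congr fun z => ?_
            rw [slope_def_field, hζS, sub_zero]
          have h1 : Tendsto (fun z => ((S z - T z) / z ^ (r + 1) / (S z / (z - ζ))) • G z)
              (𝓝[≠] ζ) (𝓝 (((S ζ - T ζ) / ζ ^ (r + 1) / deriv S ζ) • G ζ)) := by
            refine Tendsto.smul (Tendsto.div (Tendsto.div ?_ ?_ (pow_ne_zero _ h0)) hslope hζS')
              ((hG.continuous.tendsto ζ).mono_left nhdsWithin_le_nhds)
            · exact ((hS.continuous.sub hT.continuous).tendsto ζ).mono_left nhdsWithin_le_nhds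
            · exact ((continuous_pow (r + 1)).tendsto ζ).mono_left nhdsWithin_le_nhds
          have h2 : ((S ζ - T ζ) / ζ ^ (r + 1) / deriv S ζ) =
              -(T ζ / (ζ ^ (r + 1) * deriv S ζ)) := by
            rw [hζS, zero_sub, div_div, neg_div]
          rw [h2] at h1
          refine h1.congr fun z => ?_
          rw [smul_smul]
          congr 1
          rw [div_div_eq_mul_div, div_mul_eq_mul_div, div_div]
          ring)
    have i1 : CircleIntegrable (fun z => (1 / (z - 0) ^ (r + 1)) • G z) 0 (R N) := by
      refine ContinuousOn.circleIntegrable hRN.le fun z hz => ?_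
      have hz1 := pow_ne_zero (r + 1) (sub_ne_zero.2 (hz0 z hz))
      have hGz := hG z
      exact DifferentiableAt.continuousAt (𝕜 := ℂ)
        (by fun_prop (disch := assumption)) |>.continuousWithinAt
    have i2 : CircleIntegrable (fun z => ((S z - T z) / (z ^ (r + 1) * S z)) • G z) 0 (R N) := by
      refine ContinuousOn.circleIntegrable hRN.le (hd.continuousOn.mono fun z hz => ?_)
      have hz' : ‖z‖ = R N := by simpa using hz
      exact ⟨Or.inl (hSne N z hz'), fun h => (hZR N z h).ne hz'⟩
    have e3 := circleIntegral.integral_sub i1 i2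
    rw [e1, e2] at e3
    rw [smul_sub, smul_smul, ← div_eq_mul_inv, ← e3]
    refine circleIntegral.integral_congr hRN.le fun z hz => ?_
    have hzp := pow_ne_zero (r + 1) (hz0 z hz)
    have hSz := hSne N z (by simpa using hz)
    simp only [sub_zero]
    rw [← sub_smul]
    congr 1
    field_simp
    ring
  -- The growth of `G` is absorbed by `S`, leaving an integrand `O(R⁻²)` on a circle of length
  -- `2πR`.
  have hsmall : Tendsto (fun N => ∮ z in C(0, R N), (T z / (z ^ (r + 1) * S z)) • G z)
      atTop (𝓝 0) := by
    have hlim : Tendsto (fun N => 2 * Real.pi * (C * c * M) * (R N)⁻¹) atTop (𝓝 0) := by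
      simpa using (tendsto_inv_atTop_zero.comp hR).const_mul (2 * Real.pi * (C * c * M))
    refine squeeze_zero_norm (fun N => ?_) hlim
    have hRN : 0 < R N := zero_lt_one.trans_le (hR1 N)
    refine (circleIntegral.norm_integral_le_of_norm_le_const (C := C * c * M * (R N)⁻¹ ^ 2)
      hRN.le fun z hz => ?_).trans (le_of_eq ?_)
    · have hz' : ‖z‖ = R N := by simpa using hz
      have hSz : 0 < ‖S z‖ := norm_pos_iff.2 (hSne N z hz')
      have h1 := hTC z (by rw [hz']; exact hR1 N)
      have h2 := hSc N z hz'
      rw [hz'] at h1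
      rw [norm_smul, norm_div, norm_mul, norm_pow, hz', div_mul_eq_mul_div,
        div_le_iff₀ (by positivity)]
      have h3 : ‖G z‖ ≤ M * (c * ‖S z‖) :=
        (hGM z).trans (mul_le_mul_of_nonneg_left h2 hM)
      have h4 : ‖T z‖ ≤ C * R N ^ r * (R N)⁻¹ := by
        rw [← div_eq_mul_inv, le_div_iff₀ hRN, mul_comm]
        exact h1
      calc ‖T z‖ * ‖G z‖ ≤ (C * R N ^ r * (R N)⁻¹) * (M * (c * ‖S z‖)) := by gcongr
        _ = C * c * M * (R N)⁻¹ ^ 2 * (R N ^ (r + 1) * ‖S z‖) := by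
          field_simp
          ring
    · field_simp
  simp_rw [key] at hsmall
  have h5 := hsmall.const_smul ((2 * Real.pi * Complex.I : ℂ)⁻¹)
  simp only [smul_smul (2 * Real.pi * Complex.I : ℂ)⁻¹, inv_mul_cancel₀ hpi, one_smul,
    smul_zero] at h5
  have h6 := (tendsto_const_nhds (x := (r ! : ℂ)⁻¹ • iteratedDeriv r G 0)).sub h5
  simpa using h6

end Residues

/-! ### Taylor remainders and lower bounds for the complex sine and cosine. -/

section Trigonometric

theorem norm_cos_sub_taylor_le (m : ℕ) (z : ℂ) :
    ‖Complex.cos z - ∑ j ∈ Finset.range m, (-1 : ℂ) ^ j / ((2 * j)! : ℂ) * z ^ (2 * j)‖ ≤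
      ‖z‖ ^ (2 * m) * Real.exp ‖z‖ := by
  have h1 := Complex.norm_exp_sub_sum_le_norm_mul_exp (z * Complex.I) (2 * m)
  have h2 := Complex.norm_exp_sub_sum_le_norm_mul_exp (-z * Complex.I) (2 * m)
  -- Averaging the partial sums of `exp (± z I)` cancels the odd powers, so the remainder bound for
  -- `exp` carries over.
  have hs : ∀ n : ℕ, ∑ j ∈ Finset.range n, (-1 : ℂ) ^ j / ((2 * j)! : ℂ) * z ^ (2 * j) =
      ((∑ i ∈ Finset.range (2 * n), (z * Complex.I) ^ i / (i ! : ℂ)) +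
        ∑ i ∈ Finset.range (2 * n), (-z * Complex.I) ^ i / (i ! : ℂ)) / 2 := by
    intro n
    induction n with
    | zero => simp
    | succ n ih =>
      rw [Finset.sum_range_succ, ih, mul_add_one, Finset.sum_range_succ, Finset.sum_range_succ,
        Finset.sum_range_succ, Finset.sum_range_succ]
      have e1 : (z * Complex.I) ^ (2 * n) = (-1) ^ n * z ^ (2 * n) := by
        rw [mul_pow, pow_mul Complex.I, Complex.I_sq, mul_comm]
      have e2 : (-z * Complex.I) ^ (2 * n) = (-1) ^ n * z ^ (2 * n) := by
        rw [mul_pow, pow_mul Complex.I, Complex.I_sq, mul_comm, Even.neg_pow ⟨n, two_mul n⟩]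
      rw [pow_succ, pow_succ, e1, e2]
      ring
  rw [hs, Complex.cos, ← sub_div, norm_div]
  simp only [norm_mul, norm_neg, Complex.norm_I, mul_one] at h1 h2
  rw [Complex.norm_ofNat, div_le_iff₀ two_pos]
  calc _ = ‖(Complex.exp (z * Complex.I) -
          ∑ i ∈ Finset.range (2 * m), (z * Complex.I) ^ i / (i ! : ℂ)) +
        (Complex.exp (-z * Complex.I) -
          ∑ i ∈ Finset.range (2 * m), (-z * Complex.I) ^ i / (i ! : ℂ))‖ := by
        congr 1; ring
    _ ≤ _ := (norm_add_le _ _).trans (by linarith)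

theorem norm_sin_sub_taylor_le (m : ℕ) (z : ℂ) :
    ‖Complex.sin z - ∑ j ∈ Finset.range m, (-1 : ℂ) ^ j * z ^ (2 * j + 1) / ((2 * j + 1)! : ℂ)‖ ≤
      ‖z‖ ^ (2 * m) * Real.exp ‖z‖ := by
  have h1 := Complex.norm_exp_sub_sum_le_norm_mul_exp (-z * Complex.I) (2 * m)
  have h2 := Complex.norm_exp_sub_sum_le_norm_mul_exp (z * Complex.I) (2 * m)
  have hs : ∀ n : ℕ, ∑ j ∈ Finset.range n, (-1 : ℂ) ^ j * z ^ (2 * j + 1) / ((2 * j + 1)! : ℂ) =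
      ((∑ i ∈ Finset.range (2 * n), (-z * Complex.I) ^ i / (i ! : ℂ)) -
        ∑ i ∈ Finset.range (2 * n), (z * Complex.I) ^ i / (i ! : ℂ)) * Complex.I / 2 := by
    intro n
    induction n with
    | zero => simp
    | succ n ih =>
      rw [Finset.sum_range_succ, ih, mul_add_one, Finset.sum_range_succ, Finset.sum_range_succ,
        Finset.sum_range_succ, Finset.sum_range_succ]
      have e1 : (z * Complex.I) ^ (2 * n) = (-1) ^ n * z ^ (2 * n) := by
        rw [mul_pow, pow_mul Complex.I, Complex.I_sq, mul_comm]
      have e2 : (-z * Complex.I) ^ (2 * n) = (-1) ^ n * z ^ (2 * n) := by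
        rw [mul_pow, pow_mul Complex.I, Complex.I_sq, mul_comm, Even.neg_pow ⟨n, two_mul n⟩]
      rw [pow_succ (z * Complex.I), pow_succ (-z * Complex.I), e1, e2]
      linear_combination (-1) ^ n * z ^ (2 * n + 1) / ((2 * n + 1)! : ℂ) * Complex.I_sq
  rw [hs, Complex.sin, ← sub_div, ← sub_mul, norm_div, norm_mul, Complex.norm_I, mul_one]
  simp only [norm_mul, norm_neg, Complex.norm_I, mul_one] at h1 h2
  rw [Complex.norm_ofNat, div_le_iff₀ two_pos]
  calc _ = ‖(Complex.exp (-z * Complex.I) -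
          ∑ i ∈ Finset.range (2 * m), (-z * Complex.I) ^ i / (i ! : ℂ)) -
        (Complex.exp (z * Complex.I) -
          ∑ i ∈ Finset.range (2 * m), (z * Complex.I) ^ i / (i ! : ℂ))‖ := by
        congr 1; ring
    _ ≤ _ := (norm_sub_le _ _).trans (by linarith)

/-- Here `x + iy` lies on the circle of radius `R`, `w` is `|cos|` or `|sin|` there, and `s` is its
value at `x`. For `|y| ≥ 1` the `sinh` term suffices. For `|y| ≤ 1` the point lies near the real
axis, so `|x|` is within `1` of `R`, where `|s| ≥ 1/2`; since `e^{|y|} ≤ 3`, the constant `6 = 3 /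
(1/2)` works. -/
theorem exp_abs_le_of_sq_eq_add_sinh_sq {x y R s w : ℝ} (hR : 3 / 2 ≤ R)
    (hxy : x ^ 2 + y ^ 2 = R ^ 2)
    (hs : |s| = |Real.cos (R - |x|)|) (hw : 0 ≤ w) (hws : w ^ 2 = s ^ 2 + Real.sinh y ^ 2) :
    Real.exp |y| ≤ 6 * w := by
  rcases le_total 1 |y| with hy | hy
  · have h1 : Real.sinh |y| ≤ w := by
      refine le_of_sq_le_sq ?_ hw
      have : Real.sinh |y| ^ 2 = Real.sinh y ^ 2 := by
        rcases abs_choice y with h | h <;> simp [h]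
      rw [hws, this]
      exact le_add_of_nonneg_left (sq_nonneg s)
    rw [Real.sinh_eq] at h1
    have h2 : Real.exp (-|y|) ≤ 1 := Real.exp_le_one_iff.2 (by linarith)
    have h3 : 1 + 1 ≤ Real.exp |y| := by linarith [Real.add_one_le_exp |y|]
    linarith
  · have h1 : Real.exp |y| ≤ 3 := (Real.exp_le_exp.2 hy).trans Real.exp_one_lt_three.le
    have hy2 : y ^ 2 ≤ 1 := by rw [← sq_abs]; nlinarith [abs_nonneg y]
    have hx0 := abs_nonneg x
    have hx : |x| ≤ R := abs_le_of_sq_le_sq (by nlinarith) (by linarith)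
    have h4 : R - |x| ≤ 1 := by
      have : (R - |x|) * (R + |x|) ≤ 1 := by nlinarith [sq_abs x]
      nlinarith
    have h5 : 1 / 2 ≤ Real.cos (R - |x|) := by
      have := Real.one_sub_sq_div_two_le_cos (x := R - |x|)
      nlinarith
    have h6 : 1 / 2 ≤ |s| := hs ▸ h5.trans (le_abs_self _)
    have h7 : |s| ≤ w := abs_le_of_sq_le_sq (by rw [hws]; nlinarith [sq_nonneg (Real.sinh y)]) hw
    linarith

theorem norm_cos_sq (z : ℂ) :
    ‖Complex.cos z‖ ^ 2 = Real.cos z.re ^ 2 + Real.sinh z.im ^ 2 := by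
  have e : Complex.cos z = ⟨Real.cos z.re * Real.cosh z.im, -(Real.sin z.re * Real.sinh z.im)⟩ := by
    rw [Complex.cos_eq, Complex.mk_eq_add_mul_I]
    push_cast
    ring
  rw [e, Complex.sq_norm, Complex.normSq_mk]
  linear_combination (Real.cos z.re ^ 2) * Real.cosh_sq z.im +
    Real.sinh z.im ^ 2 * Real.sin_sq_add_cos_sq z.re

theorem norm_sin_sq (z : ℂ) :
    ‖Complex.sin z‖ ^ 2 = Real.sin z.re ^ 2 + Real.sinh z.im ^ 2 := by
  have h := norm_cos_sq (Real.pi / 2 - z)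
  rw [Complex.cos_pi_div_two_sub] at h
  have e1 : ((Real.pi / 2 - z : ℂ)).re = Real.pi / 2 - z.re := by
    rw [Complex.sub_re, show (Real.pi / 2 : ℂ) = ((Real.pi / 2 : ℝ) : ℂ) by push_cast; rfl,
      Complex.ofReal_re]
  have e2 : ((Real.pi / 2 - z : ℂ)).im = - z.im := by
    rw [Complex.sub_im, show (Real.pi / 2 : ℂ) = ((Real.pi / 2 : ℝ) : ℂ) by push_cast; rfl,
      Complex.ofReal_im, zero_sub]
  rw [h, e1, e2, Real.cos_pi_div_two_sub, Real.sinh_neg, neg_sq]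

theorem exp_abs_im_le_norm_cos (N : ℕ) {z : ℂ} (hz : ‖z‖ = (N + 1) * Real.pi) :
    Real.exp |z.im| ≤ 6 * ‖Complex.cos z‖ := by
  refine exp_abs_le_of_sq_eq_add_sinh_sq (x := z.re) (R := (N + 1) * Real.pi)
    (s := Real.cos z.re) ?_ ?_ ?_ (norm_nonneg _) (norm_cos_sq z)
  · nlinarith [Real.pi_gt_three, (Nat.cast_nonneg N : (0 : ℝ) ≤ N)]
  · rw [← hz, Complex.sq_norm, Complex.normSq_apply]; ring
  · have := Real.cos_nat_mul_pi_sub |z.re| (N + 1)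
    push_cast at this
    rw [this, Real.cos_abs, abs_mul, abs_pow, abs_neg, abs_one, one_pow, one_mul]

theorem exp_abs_im_le_norm_sin (N : ℕ) {z : ℂ} (hz : ‖z‖ = (N + 1 / 2) * Real.pi) :
    Real.exp |z.im| ≤ 6 * ‖Complex.sin z‖ := by
  refine exp_abs_le_of_sq_eq_add_sinh_sq (x := z.re) (R := (N + 1 / 2) * Real.pi)
    (s := Real.sin z.re) ?_ ?_ ?_ (norm_nonneg _) (norm_sin_sq z)
  · nlinarith [Real.pi_gt_three, (Nat.cast_nonneg N : (0 : ℝ) ≤ N)]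
  · rw [← hz, Complex.sq_norm, Complex.normSq_apply]; ring
  · have h := Real.cos_nat_mul_pi_sub (|z.re| - Real.pi / 2) N
    rw [show (N + 1 / 2) * Real.pi - |z.re| = N * Real.pi - (|z.re| - Real.pi / 2) by ring, h,
      Real.cos_sub_pi_div_two, abs_mul, abs_pow, abs_neg, abs_one, one_pow, one_mul]
    rcases abs_choice z.re with h | h <;> simp [h]

end Trigonometric

/-! ### Boas interpolation formulas for entire functions of exponential type one. -/

section Interpolation

variable {E : Type*} [NormedAddCommGroup E] [NormedSpace ℂ E] [CompleteSpace E]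

theorem norm_mul_norm_cos_taylor_le (m : ℕ) {z : ℂ} (hz : 1 ≤ ‖z‖) :
    ‖z‖ * ‖∑ j ∈ Finset.range (m + 1), (-1 : ℂ) ^ j / ((2 * j)! : ℂ) * z ^ (2 * j)‖ ≤
      (m + 1) * ‖z‖ ^ (2 * m + 1) := by
  have h : ‖∑ j ∈ Finset.range (m + 1), (-1 : ℂ) ^ j / ((2 * j)! : ℂ) * z ^ (2 * j)‖ ≤
      (m + 1) * ‖z‖ ^ (2 * m) := by
    refine (norm_sum_le_of_le _ (f := fun j => (-1 : ℂ) ^ j / ((2 * j)! : ℂ) * z ^ (2 * j))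
      (fun j hj => ?_)).trans (le_of_eq ?_) (b := ∑ j ∈ Finset.range (m + 1), ‖z‖ ^ (2 * m))
    · have hj' : 2 * j ≤ 2 * m := by have := Finset.mem_range.1 hj; omega
      rw [norm_mul, norm_div, norm_pow, norm_neg, norm_one, one_pow, norm_pow, Complex.norm_natCast]
      have h1 : (1 : ℝ) / ((2 * j)! : ℝ) ≤ 1 :=
        div_le_one_of_le₀ (by exact_mod_cast Nat.one_le_iff_ne_zero.2 (Nat.factorial_ne_zero _))
          (by positivity)
      exact (mul_le_of_le_one_left (by positivity) h1).trans (pow_le_pow_right₀ hz hj')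
    · simp
  calc _ ≤ ‖z‖ * ((m + 1) * ‖z‖ ^ (2 * m)) := by gcongr
    _ = _ := by ring

theorem norm_mul_norm_sin_taylor_le (m : ℕ) {z : ℂ} (hz : 1 ≤ ‖z‖) :
    ‖z‖ * ‖∑ j ∈ Finset.range (m + 1), (-1 : ℂ) ^ j * z ^ (2 * j + 1) / ((2 * j + 1)! : ℂ)‖ ≤
      (m + 1) * ‖z‖ ^ (2 * m + 2) := by
  have h : ‖∑ j ∈ Finset.range (m + 1), (-1 : ℂ) ^ j * z ^ (2 * j + 1) / ((2 * j + 1)! : ℂ)‖ ≤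
      (m + 1) * ‖z‖ ^ (2 * m + 1) := by
    refine (norm_sum_le_of_le _
      (f := fun j => (-1 : ℂ) ^ j * z ^ (2 * j + 1) / ((2 * j + 1)! : ℂ))
      (fun j hj => ?_)).trans (le_of_eq ?_) (b := ∑ j ∈ Finset.range (m + 1), ‖z‖ ^ (2 * m + 1))
    · have hj' : 2 * j + 1 ≤ 2 * m + 1 := by have := Finset.mem_range.1 hj; omega
      rw [norm_div, norm_mul, norm_pow, norm_neg, norm_one, one_pow, norm_pow, one_mul,
        Complex.norm_natCast]
      refine (div_le_self (by positivity) ?_).trans (pow_le_pow_right₀ hz hj')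
      exact_mod_cast Nat.one_le_iff_ne_zero.2 (Nat.factorial_ne_zero _)
    · simp
  calc _ ≤ ‖z‖ * ((m + 1) * ‖z‖ ^ (2 * m + 1)) := by gcongr
    _ = _ := by ring

theorem tendsto_cos_sub_taylor_quotient (m : ℕ) :
    Tendsto (fun z : ℂ => z * ((Complex.cos z -
      ∑ j ∈ Finset.range (m + 1), (-1 : ℂ) ^ j / ((2 * j)! : ℂ) * z ^ (2 * j)) /
        (z ^ (2 * m + 1 + 1) * Complex.cos z))) (𝓝[≠] 0) (𝓝 0) := by
  have hlim : Tendsto (fun z : ℂ => ‖z‖ * Real.exp ‖z‖ / ‖Complex.cos z‖) (𝓝[≠] 0) (𝓝 0) := by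
    have : ContinuousAt (fun z : ℂ => ‖z‖ * Real.exp ‖z‖ / ‖Complex.cos z‖) 0 := by
      refine ContinuousAt.div (by fun_prop) ?_ (by simp)
      exact Complex.continuous_cos.norm.continuousAt
    simpa using this.tendsto.mono_left nhdsWithin_le_nhds
  refine squeeze_zero_norm' ?_ hlim
  filter_upwards [self_mem_nhdsWithin] with z hz
  have hz0 : 0 < ‖z‖ := norm_pos_iff.2 hz
  rw [norm_mul, norm_div, norm_mul, norm_pow, ← div_div, ← mul_div_assoc]
  refine div_le_div_of_nonneg_right ?_ (norm_nonneg _)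
  rw [← mul_div_assoc, div_le_iff₀ (by positivity)]
  calc _ ≤ ‖z‖ * (‖z‖ ^ (2 * (m + 1)) * Real.exp ‖z‖) := by
        gcongr; exact norm_cos_sub_taylor_le (m + 1) z
    _ = _ := by ring

theorem tendsto_sin_sub_taylor_quotient (m : ℕ) :
    Tendsto (fun z : ℂ => z * ((Complex.sin z -
      ∑ j ∈ Finset.range (m + 1), (-1 : ℂ) ^ j * z ^ (2 * j + 1) / ((2 * j + 1)! : ℂ)) /
        (z ^ (2 * m + 2 + 1) * Complex.sin z))) (𝓝[≠] 0)
      (𝓝 ((-1) ^ (m + 1) / ((2 * m + 3)! : ℂ))) := by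
  -- One more Taylor term than in the statement: it supplies the limit, and it makes the remainder
  -- bound `‖z‖ ^ (2 * m + 4)` beat the denominator.
  have h1 : Tendsto (fun z : ℂ => (Complex.sin z - ∑ j ∈ Finset.range (m + 2),
      (-1 : ℂ) ^ j * z ^ (2 * j + 1) / ((2 * j + 1)! : ℂ)) / z ^ (2 * m + 3)) (𝓝[≠] 0) (𝓝 0) := by
    have hlim : Tendsto (fun z : ℂ => ‖z‖ * Real.exp ‖z‖) (𝓝[≠] 0) (𝓝 0) := by
      have : Continuous (fun z : ℂ => ‖z‖ * Real.exp ‖z‖) := by fun_prop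
      simpa using (this.tendsto 0).mono_left nhdsWithin_le_nhds
    refine squeeze_zero_norm' ?_ hlim
    filter_upwards [self_mem_nhdsWithin] with z hz
    have hz0 : 0 < ‖z‖ := norm_pos_iff.2 hz
    rw [norm_div, norm_pow, div_le_iff₀ (by positivity)]
    refine (norm_sin_sub_taylor_le (m + 2) z).trans (le_of_eq ?_)
    ring
  have h2 : Tendsto (fun z : ℂ => Complex.sin z / z) (𝓝[≠] 0) (𝓝 1) := by
    have := (Complex.hasDerivAt_sin 0).tendsto_slope
    simpa [slope_fun_def_field] using this
  have h3 := (h1.add_const ((-1) ^ (m + 1) / ((2 * m + 3)! : ℂ))).div h2 one_ne_zero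
  rw [zero_add, div_one] at h3
  refine h3.congr' ?_
  filter_upwards [self_mem_nhdsWithin] with z hz
  have hz0 : z ≠ 0 := hz
  simp only [Pi.div_apply]
  rw [Finset.sum_range_succ _ (m + 1), show 2 * (m + 1) + 1 = 2 * m + 3 by ring]
  have : ((2 * m + 3)! : ℂ) ≠ 0 := Nat.cast_ne_zero.2 (Nat.factorial_ne_zero _)
  rw [div_div_eq_mul_div, mul_div_assoc']
  field_simp
  ring

theorem neg_one_zpow_mul_self (k : ℤ) : (-1 : ℂ) ^ k * (-1 : ℂ) ^ k = 1 := by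
  rw [← mul_zpow]; simp

theorem Complex.cos_int_mul_pi (k : ℤ) : Complex.cos (k * Real.pi) = (-1) ^ k := by
  have := congrArg (fun x : ℝ => (x : ℂ)) (Real.cos_int_mul_pi k)
  push_cast at this
  exact this

theorem Complex.sin_pi_mul_int_sub_half (k : ℤ) :
    Complex.sin (Real.pi * (k - 1 / 2)) = -(-1) ^ k := by
  rw [show (Real.pi * (k - 1 / 2) : ℂ) = k * Real.pi - Real.pi / 2 by ring,
    Complex.sin_sub_pi_div_two, Complex.cos_int_mul_pi]

/-- The residue evaluation for `S = cos` and `r = 2m + 1`. The circle of radius `(N + 1)π` encloses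
exactly the zeros `π(k - 1/2)` with `-N ≤ k ≤ N + 1`. The origin is not a zero of `cos`, so it is
adjoined to the list of points, with residue `0`. -/
theorem tendsto_sum_A_smul {G : ℂ → E} (hG : Differentiable ℂ G) {M : ℝ}
    (hGM : ∀ z, ‖G z‖ ≤ M * Real.exp |z.im|) (m : ℕ) :
    Tendsto (fun N : ℕ => ∑ k ∈ Finset.Icc (-(N : ℤ)) (N + 1),
        (((-1 : ℝ) ^ (k + 1) * Mellin.A (m + 1) k : ℝ) : ℂ) • G (Real.pi * (k - 1 / 2)))
      atTop (𝓝 ((Real.pi : ℂ) ^ (2 * m + 1) • iteratedDeriv (2 * m + 1) G 0)) := by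
  classical
  have hpi : (Real.pi : ℂ) ≠ 0 := Complex.ofReal_ne_zero.2 Real.pi_ne_zero
  have hfac : ((2 * m + 1)! : ℂ) ≠ 0 := Nat.cast_ne_zero.2 (Nat.factorial_ne_zero _)
  have hhalf : ∀ k : ℤ, (k - 1 / 2 : ℂ) ≠ 0 := by
    intro k h
    have : (2 * k : ℂ) = 1 := by linear_combination 2 * h
    have : 2 * k = 1 := by exact_mod_cast this
    omega
  have hinj : Function.Injective fun k : ℤ => (Real.pi * (k - 1 / 2) : ℂ) := by
    intro k l h
    simpa [hpi] using h
  have hnorm : ∀ k : ℤ, ‖(Real.pi * (k - 1 / 2) : ℂ)‖ = |(k : ℝ) - 1 / 2| * Real.pi := by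
    intro k
    rw [show (Real.pi * (k - 1 / 2) : ℂ) = ((((k : ℝ) - 1 / 2) * Real.pi : ℝ) : ℂ) by
      push_cast; ring, Complex.norm_real, norm_mul, Real.norm_eq_abs,
      Real.norm_of_nonneg Real.pi_pos.le]
  have h := tendsto_sum_residues_of_quotient_bound Complex.differentiable_cos
    (T := fun z => ∑ j ∈ Finset.range (m + 1), (-1 : ℂ) ^ j / ((2 * j)! : ℂ) * z ^ (2 * j))
    (by fun_prop) hG hGM (2 * m + 1) (fun z hz => norm_mul_norm_cos_taylor_le m hz)
    (fun N => (N + 1) * Real.pi)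
    (fun N => by nlinarith [Real.pi_gt_three, (Nat.cast_nonneg N : (0 : ℝ) ≤ N)])
    ((tendsto_atTop_add_const_right _ _ tendsto_natCast_atTop_atTop).atTop_mul_const Real.pi_pos)
    (fun N z hz => exp_abs_im_le_norm_cos N hz)
    (fun N => insert 0 ((Finset.Icc (-(N : ℤ)) (N + 1)).image
      fun k : ℤ => (Real.pi * (k - 1 / 2) : ℂ)))
    (fun N => Finset.mem_insert_self _ _)
    (by
      intro N z hz
      rcases Finset.mem_insert.1 hz with rfl | hz
      · rw [norm_zero]; positivity
      · obtain ⟨k, hk, rfl⟩ := Finset.mem_image.1 hz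
        rw [hnorm]
        refine mul_lt_mul_of_pos_right ?_ Real.pi_pos
        obtain ⟨h1, h2⟩ := Finset.mem_Icc.1 hk
        have h1' : (-N : ℝ) ≤ k := by exact_mod_cast h1
        have h2' : (k : ℝ) ≤ N + 1 := by exact_mod_cast h2
        rw [abs_lt]
        constructor <;> linarith)
    (by
      intro N z hz hz0
      obtain ⟨k, rfl⟩ := Complex.cos_eq_zero_iff.1 hz0
      -- The zero indexed by `k` in `Complex.cos_eq_zero_iff` is the node of index `k + 1`.
      have e : ((2 * k + 1) * Real.pi / 2 : ℂ) = Real.pi * ((k + 1 : ℤ) - 1 / 2) := by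
        push_cast; ring
      rw [e] at hz ⊢
      rw [hnorm] at hz
      have h1 := abs_lt.1 (lt_of_mul_lt_mul_right hz Real.pi_pos.le)
      refine Finset.mem_insert_of_mem (Finset.mem_image_of_mem
        (fun k : ℤ => (Real.pi * (k - 1 / 2) : ℂ)) (Finset.mem_Icc.2 ?_))
      have h2 : (-N - 1 : ℝ) < (k + 1 : ℤ) := by linarith [h1.1]
      have h3 : ((k + 1 : ℤ) : ℝ) < N + 2 := by linarith [h1.2]
      have h2' : -(N : ℤ) - 1 < k + 1 := by exact_mod_cast h2
      have h3' : k + 1 < (N : ℤ) + 2 := by exact_mod_cast h3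
      omega)
    (by
      intro N z hz hz0
      obtain ⟨k, hk, rfl⟩ := Finset.mem_image.1 ((Finset.mem_insert.1 hz).resolve_left hz0)
      refine ⟨Complex.cos_eq_zero_iff.2 ⟨k - 1, by push_cast; ring⟩, ?_⟩
      rw [Complex.deriv_cos, Complex.sin_pi_mul_int_sub_half, neg_neg]
      exact zpow_ne_zero _ (by norm_num))
    0 (tendsto_cos_sub_taylor_quotient m)
  have h' := h.const_smul ((Real.pi : ℂ) ^ (2 * m + 1) * ((2 * m + 1)! : ℂ))
  rw [smul_smul, mul_assoc, mul_inv_cancel₀ hfac, mul_one] at h'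
  refine h'.congr fun N => ?_
  have hnot : (0 : ℂ) ∉ (Finset.Icc (-(N : ℤ)) (N + 1)).image
      fun k : ℤ => (Real.pi * (k - 1 / 2) : ℂ) := by
    intro hmem
    obtain ⟨k, -, hk⟩ := Finset.mem_image.1 hmem
    exact mul_ne_zero hpi (hhalf k) hk
  rw [Finset.sum_insert hnot, if_pos rfl, zero_smul, zero_add,
    Finset.sum_image (fun k _ l _ hkl => hinj hkl), Finset.smul_sum]
  refine Finset.sum_congr rfl fun k _ => ?_
  have hk := hhalf k
  rw [if_neg (mul_ne_zero hpi hk), smul_smul, Complex.deriv_cos, Complex.sin_pi_mul_int_sub_half,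
    neg_neg]
  congr 1
  have he := neg_one_zpow_mul_self k
  have he0 : (-1 : ℂ) ^ k ≠ 0 := zpow_ne_zero _ (by norm_num)
  have hinv : ((-1 : ℂ) ^ k)⁻¹ = (-1) ^ k := inv_eq_of_mul_eq_one_left he
  rw [Mellin.A, show 2 * (m + 1) - 1 = 2 * m + 1 by omega, show 2 * (m + 1) = 2 * m + 2 by ring]
  push_cast
  rw [zpow_add_one₀ (by norm_num), div_mul_eq_div_div, div_eq_mul_inv _ ((-1 : ℂ) ^ k), hinv]
  generalize (∑ j ∈ Finset.range (m + 1), (-1 : ℂ) ^ j / ((2 * j)! : ℂ) *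
    (Real.pi * (k - 1 / 2) : ℂ) ^ (2 * j)) = T
  generalize (-1 : ℂ) ^ k = e
  generalize (k - 1 / 2 : ℂ) = x at hk ⊢
  field_simp
  ring

/-- The residue evaluation for `S = sin` and `r = 2m + 2`, on circles of radius `(N + 1/2)π`. Here
`0` is itself a zero of `S`, and its residue `(-1)^(m+1) / (2m+3)!` produces the exceptional
coefficient `B (m + 1) 0`. -/
theorem tendsto_sum_B_smul {G : ℂ → E} (hG : Differentiable ℂ G) {M : ℝ}
    (hGM : ∀ z, ‖G z‖ ≤ M * Real.exp |z.im|) (m : ℕ) :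
    Tendsto (fun N : ℕ => ∑ k ∈ Finset.Icc (-(N : ℤ)) N,
        (((-1 : ℝ) ^ (k + 1) * Mellin.B (m + 1) k : ℝ) : ℂ) • G (Real.pi * k))
      atTop (𝓝 ((Real.pi : ℂ) ^ (2 * m + 2) • iteratedDeriv (2 * m + 2) G 0)) := by
  classical
  have hpi : (Real.pi : ℂ) ≠ 0 := Complex.ofReal_ne_zero.2 Real.pi_ne_zero
  have hfac : ((2 * m + 2)! : ℂ) ≠ 0 := Nat.cast_ne_zero.2 (Nat.factorial_ne_zero _)
  have hinj : Function.Injective fun k : ℤ => (Real.pi * k : ℂ) := by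
    intro k l h
    simpa [hpi] using h
  have hnorm : ∀ k : ℤ, ‖(Real.pi * k : ℂ)‖ = |(k : ℝ)| * Real.pi := by
    intro k
    rw [show (Real.pi * k : ℂ) = (((k : ℝ) * Real.pi : ℝ) : ℂ) by
      push_cast; ring, Complex.norm_real, norm_mul, Real.norm_eq_abs,
      Real.norm_of_nonneg Real.pi_pos.le]
  have h := tendsto_sum_residues_of_quotient_bound Complex.differentiable_sin
    (T := fun z => ∑ j ∈ Finset.range (m + 1), (-1 : ℂ) ^ j * z ^ (2 * j + 1) / ((2 * j + 1)! : ℂ))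
    (by fun_prop) hG hGM (2 * m + 2) (fun z hz => norm_mul_norm_sin_taylor_le m hz)
    (fun N => (N + 1 / 2) * Real.pi)
    (fun N => by nlinarith [Real.pi_gt_three, (Nat.cast_nonneg N : (0 : ℝ) ≤ N)])
    ((tendsto_atTop_add_const_right _ _ tendsto_natCast_atTop_atTop).atTop_mul_const Real.pi_pos)
    (fun N z hz => exp_abs_im_le_norm_sin N hz)
    (fun N => (Finset.Icc (-(N : ℤ)) N).image fun k : ℤ => (Real.pi * k : ℂ))
    (fun N => Finset.mem_image.2 ⟨0, by simp, by simp⟩)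
    (by
      intro N z hz
      obtain ⟨k, hk, rfl⟩ := Finset.mem_image.1 hz
      rw [hnorm]
      refine mul_lt_mul_of_pos_right ?_ Real.pi_pos
      obtain ⟨h1, h2⟩ := Finset.mem_Icc.1 hk
      have h1' : (-N : ℝ) ≤ k := by exact_mod_cast h1
      have h2' : (k : ℝ) ≤ N := by exact_mod_cast h2
      rw [abs_lt]
      constructor <;> linarith)
    (by
      intro N z hz hz0
      obtain ⟨k, rfl⟩ := Complex.sin_eq_zero_iff.1 hz0
      rw [mul_comm] at hz ⊢
      rw [hnorm] at hz
      have h1 := abs_lt.1 (lt_of_mul_lt_mul_right hz Real.pi_pos.le)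
      refine Finset.mem_image_of_mem
        (fun k : ℤ => (Real.pi * k : ℂ)) (Finset.mem_Icc.2 ?_)
      have h2 : (-N - 1 : ℝ) < k := by linarith [h1.1]
      have h3 : (k : ℝ) < N + 1 := by linarith [h1.2]
      have h2' : -(N : ℤ) - 1 < k := by exact_mod_cast h2
      have h3' : k < (N : ℤ) + 1 := by exact_mod_cast h3
      omega)
    (by
      intro N z hz hz0
      obtain ⟨k, hk, rfl⟩ := Finset.mem_image.1 hz
      refine ⟨Complex.sin_eq_zero_iff.2 ⟨k, by ring⟩, ?_⟩
      rw [Complex.deriv_sin, mul_comm, Complex.cos_int_mul_pi]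
      exact zpow_ne_zero _ (by norm_num))
    _ (tendsto_sin_sub_taylor_quotient m)
  have h' := h.const_smul ((Real.pi : ℂ) ^ (2 * m + 2) * ((2 * m + 2)! : ℂ))
  rw [smul_smul, mul_assoc, mul_inv_cancel₀ hfac, mul_one] at h'
  refine h'.congr fun N => ?_
  rw [Finset.sum_image (fun k _ l _ hkl => hinj hkl), Finset.smul_sum]
  refine Finset.sum_congr rfl fun k _ => ?_
  by_cases hk0 : k = 0
  · subst hk0
    rw [if_pos (by simp), Int.cast_zero, mul_zero, smul_smul]
    congr 1
    rw [Mellin.B, if_pos rfl, show 2 * m + 3 = (2 * m + 2) + 1 by ring, Nat.factorial_succ (2 * m + 2)]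
    have h3 : (2 * m + 2 + 1 : ℂ) ≠ 0 := by exact_mod_cast (2 * m + 2).succ_ne_zero
    have h4 : (2 * (m + 1) + 1 : ℂ) ≠ 0 := by exact_mod_cast (2 * (m + 1)).succ_ne_zero
    push_cast
    field_simp
    ring
  have hk : (k : ℂ) ≠ 0 := Int.cast_ne_zero.2 hk0
  rw [if_neg (mul_ne_zero hpi hk), smul_smul, Complex.deriv_sin, mul_comm (Real.pi : ℂ) k,
    Complex.cos_int_mul_pi]
  congr 1
  have he := neg_one_zpow_mul_self k
  have he0 : (-1 : ℂ) ^ k ≠ 0 := zpow_ne_zero _ (by norm_num)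
  have hinv : ((-1 : ℂ) ^ k)⁻¹ = (-1) ^ k := inv_eq_of_mul_eq_one_left he
  rw [Mellin.B, if_neg hk0, show 2 * (m + 1) = 2 * m + 2 by ring]
  push_cast
  rw [zpow_add_one₀ (by norm_num), div_mul_eq_div_div, div_eq_mul_inv _ ((-1 : ℂ) ^ k), hinv,
    mul_comm (k : ℂ) Real.pi]
  generalize (∑ j ∈ Finset.range (m + 1), (-1 : ℂ) ^ j *
    (Real.pi * k : ℂ) ^ (2 * j + 1) / ((2 * j + 1)! : ℂ)) = T
  generalize (-1 : ℂ) ^ k = e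
  generalize (k : ℂ) = x at hk ⊢
  field_simp
  ring

theorem summable_A (m : ℕ) : Summable fun k : ℤ => |Mellin.A (m + 1) k| := by
  have h1 : Summable fun k : ℤ => ((2 * m + 1)! : ℝ) * Real.pi ^ (2 * m) * (m + 1) / Real.pi *
      (1 / |(k : ℝ) + (-1 / 2)| ^ (2 : ℝ)) :=
    ((Real.summable_one_div_int_add_rpow (-1 / 2) 2).2 one_lt_two).mul_left _
  refine Summable.of_nonneg_of_le (fun _ => abs_nonneg _) (fun k => ?_) h1
  -- This makes `π |k - 1/2| ≥ 1`, as the polynomial bound on the Taylor sum requires.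
  have hx : 1 / 2 ≤ |(k : ℝ) - 1 / 2| := by
    rcases le_or_gt k 0 with hk | hk
    · have : (k : ℝ) ≤ 0 := by exact_mod_cast hk
      exact le_abs.2 (Or.inr (by linarith))
    · have : (1 : ℝ) ≤ k := by exact_mod_cast hk
      exact le_abs.2 (Or.inl (by linarith))
  rw [show (k : ℝ) + (-1 / 2) = k - 1 / 2 by ring, Real.rpow_two, Mellin.A,
    show 2 * (m + 1) - 1 = 2 * m + 1 by omega]
  generalize (k : ℝ) - 1 / 2 = x at hx ⊢
  have hx0 : 0 < |x| := by linarith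
  have hz : ‖((Real.pi * x : ℝ) : ℂ)‖ = Real.pi * |x| := by
    rw [Complex.norm_real, norm_mul, Real.norm_of_nonneg Real.pi_pos.le, Real.norm_eq_abs]
  have hT := norm_mul_norm_cos_taylor_le m (z := ((Real.pi * x : ℝ) : ℂ))
    (by rw [hz]; nlinarith [Real.pi_gt_three])
  rw [show ∑ j ∈ Finset.range (m + 1), (-1 : ℂ) ^ j / ((2 * j)! : ℂ) *
      ((Real.pi * x : ℝ) : ℂ) ^ (2 * j) = ((∑ j ∈ Finset.range (m + 1), (-1 : ℝ) ^ j /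
      ((2 * j)! : ℝ) * (Real.pi * x) ^ (2 * j) : ℝ) : ℂ) by push_cast; rfl, hz,
    Complex.norm_real, Real.norm_eq_abs] at hT
  rw [abs_mul, abs_div, abs_mul, abs_pow, abs_of_pos Real.pi_pos, Nat.abs_cast]
  generalize |∑ j ∈ Finset.range (m + 1), (-1 : ℝ) ^ j /
      ((2 * j)! : ℝ) * (Real.pi * x) ^ (2 * j)| = T at hT ⊢
  have hT' : T ≤ (m + 1) * (Real.pi * |x|) ^ (2 * m) := by
    refine le_of_mul_le_mul_left (hT.trans (le_of_eq (by ring))) (mul_pos Real.pi_pos hx0)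
  calc _ ≤ ((2 * m + 1)! : ℝ) / (Real.pi * |x| ^ (2 * (m + 1))) *
        ((m + 1) * (Real.pi * |x|) ^ (2 * m)) := by gcongr
    _ = _ := by field_simp; ring

theorem summable_B (m : ℕ) : Summable fun k : ℤ => |Mellin.B (m + 1) k| := by
  have h1 : Summable fun k : ℤ => ((2 * m + 2)! : ℝ) * Real.pi ^ (2 * m) * (m + 1) *
      (1 / |(k : ℝ) + 0| ^ (2 : ℝ)) :=
    ((Real.summable_one_div_int_add_rpow 0 2).2 one_lt_two).mul_left _
  -- The index `0` has to be dropped: the comparison term there is `1 / 0 = 0`, while `B (m + 1) 0`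
  -- is nonzero.
  refine Summable.of_norm_bounded_eventually h1 ?_
  filter_upwards [(Set.finite_singleton (0 : ℤ)).compl_mem_cofinite] with k hk
  have hk0 : k ≠ 0 := hk
  have hx : 1 ≤ |(k : ℝ)| := by exact_mod_cast Int.one_le_abs hk0
  rw [add_zero, Real.rpow_two, Mellin.B, if_neg hk0, Real.norm_eq_abs, abs_abs, show 2 * (m + 1) = 2 * m + 2 by ring]
  generalize (k : ℝ) = x at hx ⊢
  have hx0 : 0 < |x| := by linarith
  have hz : ‖((Real.pi * x : ℝ) : ℂ)‖ = Real.pi * |x| := by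
    rw [Complex.norm_real, norm_mul, Real.norm_of_nonneg Real.pi_pos.le, Real.norm_eq_abs]
  have hT := norm_mul_norm_sin_taylor_le m (z := ((Real.pi * x : ℝ) : ℂ))
    (by rw [hz]; nlinarith [Real.pi_gt_three])
  rw [show ∑ j ∈ Finset.range (m + 1), (-1 : ℂ) ^ j *
      ((Real.pi * x : ℝ) : ℂ) ^ (2 * j + 1) / ((2 * j + 1)! : ℂ) =
      ((∑ j ∈ Finset.range (m + 1), (-1 : ℝ) ^ j * (Real.pi * x) ^ (2 * j + 1) /
      ((2 * j + 1)! : ℝ) : ℝ) : ℂ) by push_cast; rfl, hz,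
    Complex.norm_real, Real.norm_eq_abs] at hT
  rw [abs_mul, abs_div, abs_mul, abs_pow, abs_of_pos Real.pi_pos, Nat.abs_cast]
  generalize |∑ j ∈ Finset.range (m + 1), (-1 : ℝ) ^ j * (Real.pi * x) ^ (2 * j + 1) /
      ((2 * j + 1)! : ℝ)| = T at hT ⊢
  have hT' : T ≤ (m + 1) * (Real.pi * |x|) ^ (2 * m + 1) := by
    refine le_of_mul_le_mul_left (hT.trans (le_of_eq (by ring))) (mul_pos Real.pi_pos hx0)
  calc _ ≤ ((2 * m + 2)! : ℝ) / (Real.pi * |x| ^ (2 * m + 2 + 1)) *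
        ((m + 1) * (Real.pi * |x|) ^ (2 * m + 1)) := by gcongr
    _ = _ := by field_simp; ring

end Interpolation

/-! ### Entire extension of smooth curves with uniformly bounded derivatives. -/

section EntireExtension

variable {E : Type*} [NormedAddCommGroup E] [NormedSpace ℂ E]

theorem norm_exp_term_smul_le {a : ℕ → E} {M : ℝ} (ha : ∀ n, ‖a n‖ ≤ M) (z : ℂ) (n : ℕ) :
    ‖z ^ n • (n ! : ℂ)⁻¹ • a n‖ ≤ ‖z‖ ^ n / (n ! : ℝ) * M := by
  rw [norm_smul, norm_smul, norm_pow, norm_inv, Complex.norm_natCast, ← mul_assoc,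
    ← div_eq_mul_inv]
  exact mul_le_mul_of_nonneg_left (ha n) (by positivity)

theorem norm_exp_series_le {a : ℕ → E} {M : ℝ} (ha : ∀ n, ‖a n‖ ≤ M) (z : ℂ) :
    ‖∑' n, z ^ n • (n ! : ℂ)⁻¹ • a n‖ ≤ M * Real.exp ‖z‖ := by
  have h : HasSum (fun n => ‖z‖ ^ n / (n ! : ℝ) * M) (Real.exp ‖z‖ * M) := by
    rw [Real.exp_eq_exp_ℝ]
    exact (NormedSpace.expSeries_div_hasSum_exp ‖z‖).mul_right M
  rw [mul_comm]
  exact tsum_of_norm_bounded h (norm_exp_term_smul_le ha z)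

/-- The derivative of the remainder of order `N + 1` of `h k` is the remainder of order `N` of `h (k
+ 1)`, so the mean value inequality drives the induction. This is why `k` is quantified inside. -/
theorem norm_sub_taylor_le_of_nonneg {h : ℕ → ℝ → E} {M : ℝ}
    (hd : ∀ n t, HasDerivAt (h n) (h (n + 1) t) t) (hM : ∀ n t, ‖h n t‖ ≤ M) (N : ℕ) :
    ∀ k, ∀ t, 0 ≤ t → ‖h k t - ∑ n ∈ Finset.range N, (t ^ n / (n ! : ℝ)) • h (k + n) 0‖ ≤
      M * (t ^ N / (N ! : ℝ)) := by
  induction N with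
  | zero => intro k t _; simpa using hM k t
  | succ N ih =>
    intro k t ht
    have hpow : ∀ n : ℕ, ∀ x : ℝ,
        HasDerivAt (fun x : ℝ => x ^ (n + 1) / ((n + 1)! : ℝ)) (x ^ n / (n ! : ℝ)) x := by
      intro n x
      have h1 := (hasDerivAt_pow (n + 1) x).div_const ((n + 1)! : ℝ)
      refine h1.congr_deriv ?_
      rw [Nat.factorial_succ]
      push_cast
      have : (n + 1 : ℝ) ≠ 0 := by positivity
      field_simp
    have hder : ∀ x, HasDerivAt
        (fun x => h k x - ∑ n ∈ Finset.range (N + 1), (x ^ n / (n ! : ℝ)) • h (k + n) 0)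
        (h (k + 1) x - ∑ n ∈ Finset.range N, (x ^ n / (n ! : ℝ)) • h (k + 1 + n) 0) x := by
      intro x
      refine (hd k x).sub ?_
      simp only [Finset.sum_range_succ']
      have h2 := HasDerivAt.fun_sum (u := Finset.range N) fun n _ =>
        (hpow n x).smul_const (h (k + (n + 1)) 0)
      simpa [add_assoc, add_comm, add_left_comm] using h2.add_const (h k 0)
    refine image_norm_le_of_norm_deriv_right_le_deriv_boundary
      (fun x _ => (hder x).continuousAt.continuousWithinAt)
      (fun x _ => (hder x).hasDerivWithinAt) (B := fun x => M * (x ^ (N + 1) / ((N + 1)! : ℝ)))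
      (B' := fun x => M * (x ^ N / (N ! : ℝ))) ?_ (fun x => (hpow N x).const_mul M)
      (fun x hx => ih (k + 1) x hx.1) (right_mem_Icc.2 ht)
    simp [Finset.sum_range_succ']

theorem tendsto_taylor_of_nonneg {h : ℕ → ℝ → E} {M : ℝ}
    (hd : ∀ n t, HasDerivAt (h n) (h (n + 1) t) t) (hM : ∀ n t, ‖h n t‖ ≤ M) {t : ℝ}
    (ht : 0 ≤ t) :
    Tendsto (fun N => ∑ n ∈ Finset.range N, (t ^ n / (n ! : ℝ)) • h n 0) atTop (𝓝 (h 0 t)) := by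
  have hlim : Tendsto (fun N : ℕ => M * (t ^ N / (N ! : ℝ))) atTop (𝓝 0) := by
    simpa using (FloorSemiring.tendsto_pow_div_factorial_atTop t).const_mul M
  have h1 := squeeze_zero_norm
    (fun N => by simpa using norm_sub_taylor_le_of_nonneg hd hM N 0 t ht) hlim
  simpa using (tendsto_const_nhds (x := h 0 t)).sub h1

variable [CompleteSpace E]

theorem summable_exp_term_smul {a : ℕ → E} {M : ℝ} (ha : ∀ n, ‖a n‖ ≤ M) (z : ℂ) :
    Summable fun n => z ^ n • (n ! : ℂ)⁻¹ • a n :=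
  Summable.of_norm_bounded ((Real.summable_pow_div_factorial ‖z‖).mul_right M)
    (norm_exp_term_smul_le ha z)

theorem hasFPowerSeriesOnBall_exp_series {a : ℕ → E} {M : ℝ} (ha : ∀ n, ‖a n‖ ≤ M) :
    HasFPowerSeriesOnBall (fun z : ℂ => ∑' n, z ^ n • (n ! : ℂ)⁻¹ • a n)
      (fun n => ContinuousMultilinearMap.mkPiRing ℂ (Fin n) ((n ! : ℂ)⁻¹ • a n)) 0 ⊤ where
  r_le := by
    refine (FormalMultilinearSeries.radius_eq_top_of_summable_norm _ fun r => ?_).ge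
    refine Summable.of_nonneg_of_le (fun n => by positivity) (fun n => ?_)
      ((Real.summable_pow_div_factorial r).mul_right M)
    have := norm_exp_term_smul_le ha ((r : ℝ) : ℂ) n
    rw [norm_smul, norm_pow, Complex.norm_real, Real.norm_of_nonneg r.coe_nonneg] at this
    rw [ContinuousMultilinearMap.norm_mkPiRing, mul_comm]
    exact this
  r_pos := ENNReal.zero_lt_top
  hasSum := by
    intro y _
    simpa using (summable_exp_term_smul ha y).hasSum

theorem iteratedDeriv_exp_series {a : ℕ → E} {M : ℝ} (ha : ∀ n, ‖a n‖ ≤ M) (n : ℕ) :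
    iteratedDeriv n (fun z : ℂ => ∑' n, z ^ n • (n ! : ℂ)⁻¹ • a n) 0 = a n := by
  rw [iteratedDeriv_eq_iteratedFDeriv, ← (hasFPowerSeriesOnBall_exp_series ha).factorial_smul 1 n,
    ContinuousMultilinearMap.mkPiRing_apply, ← Nat.cast_smul_eq_nsmul ℂ]
  have : (n ! : ℂ) ≠ 0 := Nat.cast_ne_zero.2 (Nat.factorial_ne_zero _)
  simp [smul_smul, this]

theorem differentiable_exp_series {a : ℕ → E} {M : ℝ} (ha : ∀ n, ‖a n‖ ≤ M) :
    Differentiable ℂ (fun z : ℂ => ∑' n, z ^ n • (n ! : ℂ)⁻¹ • a n) := by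
  have := (hasFPowerSeriesOnBall_exp_series ha).differentiableOn
  rw [Metric.eball_top] at this
  exact differentiableOn_univ.1 this

/-- A smooth curve with uniformly bounded derivatives is the sum of its Taylor series. -/
theorem exp_series_eq_of_hasDerivAt {h : ℕ → ℝ → E} {M : ℝ}
    (hd : ∀ n t, HasDerivAt (h n) (h (n + 1) t) t) (hM : ∀ n t, ‖h n t‖ ≤ M) (t : ℝ) :
    ∑' n, (t : ℂ) ^ n • (n ! : ℂ)⁻¹ • h n 0 = h 0 t := by
  have hs := (summable_exp_term_smul (fun n => hM n 0) (t : ℂ)).hasSum.tendsto_sum_nat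
  refine tendsto_nhds_unique hs ?_
  have hconv : ∀ n (s : ℝ) (x : E), (s ^ n / (n ! : ℝ)) • x = (s : ℂ) ^ n • (n ! : ℂ)⁻¹ • x := by
    intro n s x
    rw [smul_smul, ← div_eq_mul_inv, ← Complex.coe_smul]
    push_cast
    rfl
  rcases le_total 0 t with ht | ht
  · simpa only [hconv] using tendsto_taylor_of_nonneg hd hM ht
  -- Negative times reduce to positive ones by reversing the curve.
  · have h1 := tendsto_taylor_of_nonneg (h := fun n s => (-1 : ℝ) ^ n • h n (-s)) (M := M)
      (fun n s => by
        have := ((hd n (-s)).scomp s (hasDerivAt_neg s)).const_smul ((-1 : ℝ) ^ n)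
        refine this.congr_deriv ?_
        rw [smul_smul, ← pow_succ])
      (fun n s => by simpa [norm_smul] using hM n (-s)) (neg_nonneg.2 ht)
    simp only [pow_zero, one_smul, neg_neg, neg_zero] at h1
    refine h1.congr fun N => Finset.sum_congr rfl fun n _ => ?_
    rw [← hconv, smul_smul, div_mul_eq_mul_div, ← mul_pow, neg_mul_neg, mul_one]

/-- A smooth curve with uniformly bounded derivatives extends to an entire function of
exponential type one. -/
theorem exists_entire_extension {h : ℕ → ℝ → E} {M : ℝ}
    (hd : ∀ n t, HasDerivAt (h n) (h (n + 1) t) t) (hM : ∀ n t, ‖h n t‖ ≤ M) :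
    ∃ G : ℂ → E, Differentiable ℂ G ∧ (∀ t : ℝ, G t = h 0 t) ∧
      (∀ z, ‖G z‖ ≤ M * Real.exp |z.im|) ∧ ∀ n, iteratedDeriv n G 0 = h n 0 := by
  have hG := differentiable_exp_series fun n => hM n 0
  refine ⟨_, hG, exp_series_eq_of_hasDerivAt hd hM, fun z => ?_,
    iteratedDeriv_exp_series fun n => hM n 0⟩
  have hGx := differentiable_exp_series fun n => hM n z.re
  -- Recentre the series at `z.re`. Both sides are entire and agree for real `w`, hence everywhere.
  -- The recentred coefficients are still bounded by `M`, so at `w = i Im z` the bound is `M e^{|Im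
  -- z|}` instead of `M e^{|z|}`.
  have heq : (fun w : ℂ => ∑' n, (z.re + w) ^ n • (n ! : ℂ)⁻¹ • h n 0) =
      fun w : ℂ => ∑' n, w ^ n • (n ! : ℂ)⁻¹ • h n z.re := by
    refine AnalyticOnNhd.eq_of_frequently_eq (𝕜 := ℂ) (z₀ := 0)
      ((hG.comp (differentiable_id.const_add (z.re : ℂ))).differentiableOn.analyticOnNhd
        isOpen_univ)
      (hGx.differentiableOn.analyticOnNhd isOpen_univ) ?_
    have hr : ∀ t : ℝ, ∑' n, (z.re + t : ℂ) ^ n • (n ! : ℂ)⁻¹ • h n 0 =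
        ∑' n, (t : ℂ) ^ n • (n ! : ℂ)⁻¹ • h n z.re := by
      intro t
      have h1 := exp_series_eq_of_hasDerivAt hd hM (z.re + t)
      have h2 := exp_series_eq_of_hasDerivAt (h := fun n s => h n (z.re + s)) (M := M)
        (fun n s => (hd n (z.re + s)).comp_const_add z.re s) (fun n s => hM n _) t
      simp only [add_zero] at h2
      push_cast at h1
      rw [h1, h2]
    have hlim : Tendsto (fun t : ℝ => (t : ℂ)) (𝓝[≠] 0) (𝓝[≠] 0) := by
      refine tendsto_nhdsWithin_iff.2 ⟨?_, ?_⟩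
      · simpa using (Complex.continuous_ofReal.tendsto 0).mono_left
          (nhdsWithin_le_nhds (s := {(0 : ℝ)}ᶜ))
      · filter_upwards [self_mem_nhdsWithin] with t ht
        simpa using ht
    exact hlim.frequently (Eventually.of_forall hr).frequently
  have h1 := congrFun heq (z.im * Complex.I)
  simp only [Complex.re_add_im] at h1
  rw [h1]
  simpa using norm_exp_series_le (fun n => hM n z.re) (z.im * Complex.I)

/-! ### Unconditional summation of the interpolation series. -/

theorem tendsto_Icc_neg_nat_atTop (c : ℤ) (hc : 0 ≤ c) :
    Tendsto (fun N : ℕ => Finset.Icc (-(N : ℤ)) (N + c)) atTop atTop := by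
  refine tendsto_atTop_finset_of_monotone (fun N M h => Finset.Icc_subset_Icc ?_ ?_) fun k => ?_
  · simpa using h
  · simpa using h
  · exact ⟨k.natAbs, Finset.mem_Icc.2 ⟨by omega, by omega⟩⟩

/-- Absolute summability of the coefficients gives convergence; the residue formula, a limit along
the intervals `[-N, N + 1]` only, then identifies the sum. -/
theorem hasSum_A_smul {h : ℕ → ℝ → E} {M : ℝ}
    (hd : ∀ n t, HasDerivAt (h n) (h (n + 1) t) t) (hM : ∀ n t, ‖h n t‖ ≤ M) (m : ℕ) :
    HasSum (fun k : ℤ => ((-1 : ℝ) ^ (k + 1) * Mellin.A (m + 1) k) • h 0 (Real.pi * (k - 1 / 2)))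
      (Real.pi ^ (2 * m + 1) • h (2 * m + 1) 0) := by
  obtain ⟨G, hG, hGh, hGM, hGd⟩ := exists_entire_extension hd hM
  have hs : Summable (fun k : ℤ =>
      ((-1 : ℝ) ^ (k + 1) * Mellin.A (m + 1) k) • h 0 (Real.pi * (k - 1 / 2))) := by
    refine Summable.of_norm_bounded ((summable_A m).mul_right M) fun k => ?_
    rw [norm_smul, norm_mul, norm_zpow, norm_neg, norm_one, one_zpow, one_mul, Real.norm_eq_abs]
    exact mul_le_mul_of_nonneg_left (hM _ _) (abs_nonneg _)
  have h1 := tendsto_sum_A_smul hG hGM m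
  have h2 := hs.hasSum.comp (tendsto_Icc_neg_nat_atTop 1 zero_le_one)
  rw [hGd] at h1
  have h3 : ((Real.pi : ℂ) ^ (2 * m + 1) • h (2 * m + 1) 0) =
      Real.pi ^ (2 * m + 1) • h (2 * m + 1) 0 := by
    rw [← Complex.coe_smul]; push_cast; rfl
  rw [h3] at h1
  rw [← tendsto_nhds_unique h2 (h1.congr fun N => Finset.sum_congr rfl fun k _ => ?_)]
  · exact hs.hasSum
  · beta_reduce
    rw [Complex.coe_smul, ← hGh]
    push_cast
    rfl

theorem hasSum_B_smul {h : ℕ → ℝ → E} {M : ℝ}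
    (hd : ∀ n t, HasDerivAt (h n) (h (n + 1) t) t) (hM : ∀ n t, ‖h n t‖ ≤ M) (m : ℕ) :
    HasSum (fun k : ℤ => ((-1 : ℝ) ^ (k + 1) * Mellin.B (m + 1) k) • h 0 (Real.pi * k))
      (Real.pi ^ (2 * m + 2) • h (2 * m + 2) 0) := by
  obtain ⟨G, hG, hGh, hGM, hGd⟩ := exists_entire_extension hd hM
  have hs : Summable (fun k : ℤ =>
      ((-1 : ℝ) ^ (k + 1) * Mellin.B (m + 1) k) • h 0 (Real.pi * k)) := by
    refine Summable.of_norm_bounded ((summable_B m).mul_right M) fun k => ?_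
    rw [norm_smul, norm_mul, norm_zpow, norm_neg, norm_one, one_zpow, one_mul, Real.norm_eq_abs]
    exact mul_le_mul_of_nonneg_left (hM _ _) (abs_nonneg _)
  have h1 := tendsto_sum_B_smul hG hGM m
  have h2 := hs.hasSum.comp (tendsto_Icc_neg_nat_atTop 0 le_rfl)
  rw [hGd] at h1
  have h3 : ((Real.pi : ℂ) ^ (2 * m + 2) • h (2 * m + 2) 0) =
      Real.pi ^ (2 * m + 2) • h (2 * m + 2) 0 := by
    rw [← Complex.coe_smul]; push_cast; rfl
  rw [h3] at h1
  rw [← tendsto_nhds_unique h2 (h1.congr fun N => ?_)]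
  · exact hs.hasSum
  · simp only [Function.comp_apply, add_zero]
    refine Finset.sum_congr rfl fun k _ => ?_
    rw [Complex.coe_smul, ← hGh]
    push_cast
    rfl

/-- The interpolation formula applied to `G = sin`: at the nodes `sin` takes the values
`(-1)^(k+1)`, which cancel the signs in the series, `A 1 k` is nonnegative, and `sin' 0 = 1`. -/
theorem hasSum_abs_A_one : HasSum (fun k : ℤ => |Mellin.A 1 k|) Real.pi := by
  have hG : ∀ z : ℂ, ‖Complex.sin z‖ ≤ 1 * Real.exp |z.im| := by
    intro z
    rw [one_mul]
    refine le_of_sq_le_sq ?_ (Real.exp_pos _).le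
    rw [norm_sin_sq]
    have h1 := Real.sin_sq_le_one z.re
    have h2 := Real.cosh_sq z.im
    have h3 : Real.cosh z.im ≤ Real.exp |z.im| := by
      rw [← Real.cosh_abs, Real.cosh_eq]
      have : Real.exp (-|z.im|) ≤ Real.exp |z.im| :=
        Real.exp_le_exp.2 (by linarith [abs_nonneg z.im])
      linarith
    nlinarith [Real.cosh_pos z.im]
  have h1 := tendsto_sum_A_smul Complex.differentiable_sin hG 0
  have h2 := (summable_A 0).hasSum.comp (tendsto_Icc_neg_nat_atTop 1 zero_le_one)
  have h3 := (Complex.continuous_ofReal.tendsto _).comp h2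
  have h4 := tendsto_nhds_unique h3 (h1.congr fun N => ?_)
  · simp only [mul_zero, zero_add, pow_one, iteratedDeriv_one, Complex.deriv_sin,
      Complex.cos_zero, smul_eq_mul, mul_one, Complex.ofReal_inj] at h4
    rw [← h4]
    exact (summable_A 0).hasSum
  · simp only [Function.comp_apply, Complex.ofReal_sum]
    refine Finset.sum_congr rfl fun k _ => ?_
    have hpos : 0 ≤ Mellin.A (0 + 1) k := by
      simp only [Mellin.A, zero_add, mul_one]
      norm_num
      have := Real.pi_pos
      positivity
    rw [abs_of_nonneg hpos, Complex.sin_pi_mul_int_sub_half, smul_eq_mul]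
    push_cast
    rw [zpow_add_one₀ (by norm_num)]
    linear_combination (Mellin.A (0 + 1) k : ℂ) * neg_one_zpow_mul_self k

end EntireExtension

/-! ### The Mellin translation group, Bernstein's inequality and the Riesz–Boas operators. -/

namespace Mellin

variable (p : ℝ≥0∞) [Fact (1 ≤ p)]

theorem U_add (s t : ℝ) (f : X p) : U p (s + t) f = U p s (U p t f) := by
  have h := Lp.compMeasurePreserving_comp_apply f (measurePreserving_dilation t)
    (measurePreserving_dilation s)
  refine Eq.trans ?_ h
  change Lp.compMeasurePreserving _ _ f = _
  congr 1
  congr 1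
  funext x
  simp only [Function.comp_apply]
  rw [← mul_assoc, ← Real.exp_add, add_comm]

theorem U_zero (f : X p) : U p 0 f = f := by
  refine Eq.trans ?_ (Lp.compMeasurePreserving_id_apply f)
  change Lp.compMeasurePreserving _ _ f = _
  congr 1
  congr 1
  funext x
  simp

variable {p}

/-- Differentiability at `0` propagates to every `t` through `U(s) = U(t) U(s - t)`. -/
theorem hasDerivAt_U {f : X p} (hf : InDomain p f) (t : ℝ) :
    HasDerivAt (fun s => U p s f) (U p t (Theta p f)) t := by
  have h0 : HasDerivAt (fun s => U p s f) (Theta p f) (t - t) := by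
    rw [sub_self]
    exact hf.hasDerivAt
  have h1 : HasDerivAt (fun s => U p (s - t) f) (Theta p f) t := h0.comp_sub_const t t
  have h2 := ((U p t).toContinuousLinearMap.restrictScalars ℝ).hasFDerivAt.comp_hasDerivAt t h1
  refine h2.congr_of_eventuallyEq (Eventually.of_forall fun s => ?_)
  simp [← U_add]

theorem theta_mem_powDomain {f : X p} (hf : ∀ k, f ∈ powDomain p k) (k : ℕ) :
    Theta p f ∈ powDomain p k :=
  (hf (k + 1)).2

theorem theta_iterate_mem_powDomain {f : X p} (hf : ∀ k, f ∈ powDomain p k) (n : ℕ) :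
    ∀ k, (Theta p)^[n] f ∈ powDomain p k := by
  induction n generalizing f with
  | zero => exact hf
  | succ n ih => exact ih (theta_mem_powDomain hf)

/-- Rescaling time by `σ` normalises the exponential type to one, so that a single constant bounds
all derivatives (`norm_scaled_U_le`). -/
theorem hasDerivAt_scaled_U {f : X p} (hf : ∀ k, f ∈ powDomain p k) (σ : ℝ) (n : ℕ) (t : ℝ) :
    HasDerivAt (fun s => σ⁻¹ ^ n • U p (s / σ) ((Theta p)^[n] f))
      (σ⁻¹ ^ (n + 1) • U p (t / σ) ((Theta p)^[n + 1] f)) t := by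
  have h1 := hasDerivAt_U (theta_iterate_mem_powDomain hf n 1).1 (t / σ)
  have h2 := (h1.scomp t ((hasDerivAt_id t).div_const σ)).const_smul (σ⁻¹ ^ n)
  refine h2.congr_deriv ?_
  rw [smul_smul, Function.iterate_succ_apply', one_div, ← pow_succ]

theorem norm_scaled_U_le {f : X p} {σ M : ℝ} (hσ : 0 < σ)
    (hM : ∀ n, ‖(Theta p)^[n] f‖ ≤ σ ^ n * M) (n : ℕ) (t : ℝ) :
    ‖σ⁻¹ ^ n • U p (t / σ) ((Theta p)^[n] f)‖ ≤ M := by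
  rw [norm_smul, LinearIsometry.norm_map, norm_pow, norm_inv, Real.norm_of_nonneg hσ.le, inv_pow,
    inv_mul_le_iff₀ (pow_pos hσ n)]
  exact hM n

theorem summable_rieszBoasTerm (r : ℕ) (hr : 1 ≤ r) (σ : ℝ) (g : X p) :
    Summable (rieszBoasTerm p r σ g) := by
  rcases Nat.even_or_odd' r with ⟨m, rfl | rfl⟩
  · obtain ⟨m, rfl⟩ : ∃ n, m = n + 1 := ⟨m - 1, by omega⟩
    refine Summable.of_norm_bounded ((summable_B m).mul_right ‖g‖) fun k => le_of_eq ?_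
    rw [rieszBoasTerm, if_pos (even_two_mul _), Nat.mul_div_cancel_left _ two_pos, norm_smul,
      norm_mul, norm_zpow, norm_neg, norm_one, one_zpow, one_mul, LinearIsometry.norm_map,
      Real.norm_eq_abs]
  · refine Summable.of_norm_bounded ((summable_A m).mul_right ‖g‖) fun k => le_of_eq ?_
    rw [rieszBoasTerm, if_neg (Nat.not_even_iff_odd.2 (odd_two_mul_add_one m)),
      show (2 * m + 1 + 1) / 2 = m + 1 by omega, norm_smul,
      norm_mul, norm_zpow, norm_neg, norm_one, one_zpow, one_mul, LinearIsometry.norm_map,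
      Real.norm_eq_abs]

/-- The Riesz–Boas formula for vectors of exponential type. -/
theorem theta_iterate_eq_rieszBoas {f : X p} (hf : ∀ k, f ∈ powDomain p k) {σ M : ℝ}
    (hσ : 0 < σ) (hM : ∀ n, ‖(Theta p)^[n] f‖ ≤ σ ^ n * M) (r : ℕ) (hr : 1 ≤ r) :
    (Theta p)^[r] f = rieszBoas p r σ f := by
  have hpi := Real.pi_ne_zero
  have hd := hasDerivAt_scaled_U hf σ
  have hb := norm_scaled_U_le hσ hM
  have key : HasSum (rieszBoasTerm p r σ f) ((Real.pi / σ) ^ r • (Theta p)^[r] f) := by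
    have hscale : Real.pi ^ r • σ⁻¹ ^ r • U p (0 / σ) ((Theta p)^[r] f) =
        (Real.pi / σ) ^ r • (Theta p)^[r] f := by
      rw [zero_div, U_zero, smul_smul, ← mul_pow, div_eq_mul_inv]
    rw [← hscale]
    rcases Nat.even_or_odd' r with ⟨m, rfl | rfl⟩
    · obtain ⟨m, rfl⟩ : ∃ n, m = n + 1 := ⟨m - 1, by omega⟩
      refine (hasSum_B_smul hd hb m).congr_fun fun k => ?_
      rw [rieszBoasTerm, if_pos (even_two_mul _), Nat.mul_div_cancel_left _ two_pos]
      simp only [pow_zero, one_smul, Function.iterate_zero, id_eq]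
      rfl
    · refine (hasSum_A_smul hd hb m).congr_fun fun k => ?_
      rw [rieszBoasTerm, if_neg (Nat.not_even_iff_odd.2 (odd_two_mul_add_one m)),
        show (2 * m + 1 + 1) / 2 = m + 1 by omega, div_mul_eq_mul_div]
      simp only [pow_zero, one_smul, Function.iterate_zero, id_eq]
      rfl
  rw [rieszBoas, key.tsum_eq, smul_smul, ← mul_pow, div_mul_div_cancel₀ hpi, div_self hσ.ne',
    one_pow, one_smul]

/-- Bernstein's inequality. -/
theorem norm_theta_le {f : X p} (hf : ∀ k, f ∈ powDomain p k) {σ M : ℝ}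
    (hσ : 0 < σ) (hM : ∀ n, ‖(Theta p)^[n] f‖ ≤ σ ^ n * M) : ‖Theta p f‖ ≤ σ * ‖f‖ := by
  have h1 := theta_iterate_eq_rieszBoas hf hσ hM 1 le_rfl
  rw [Function.iterate_one] at h1
  -- Each `U(t)` is an isometry and the coefficients have absolute sum `π`, which the factor `σ / π`
  -- turns into `σ`. The constant `M` is gone from the bound.
  have h2 : ‖∑' k, rieszBoasTerm p 1 σ f k‖ ≤ Real.pi * ‖f‖ := by
    refine tsum_of_norm_bounded (hasSum_abs_A_one.mul_right ‖f‖) fun k => le_of_eq ?_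
    rw [rieszBoasTerm, if_neg Nat.not_even_one, norm_smul, norm_mul, norm_zpow, norm_neg,
      norm_one, one_zpow, one_mul, LinearIsometry.norm_map, Real.norm_eq_abs]
  have hpi := Real.pi_pos
  rw [h1, rieszBoas, pow_one, norm_smul, Real.norm_of_nonneg (by positivity)]
  calc σ / Real.pi * ‖∑' k, rieszBoasTerm p 1 σ f k‖ ≤ σ / Real.pi * (Real.pi * ‖f‖) := by gcongr
    _ = σ * ‖f‖ := by field_simp

/-- The hypothesis on `f` bounds `Θ^(k+1) f` only by a multiple of `‖f‖`. Bernstein's inequality at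
each `Θ^k (Θ f)` gains one factor `σ` at a time relative to `‖Θ f‖`. -/
theorem theta_mem_bernstein {f : X p} {σ : ℝ} (hσ : 0 < σ) (hf : f ∈ Bernstein p σ) :
    Theta p f ∈ Bernstein p σ := by
  refine ⟨theta_mem_powDomain hf.1, fun k => ?_⟩
  induction k with
  | zero => simp
  | succ k ih =>
    rw [Function.iterate_succ_apply', pow_succ', mul_assoc]
    refine (norm_theta_le (M := σ ^ (k + 1) * ‖f‖)
      (theta_iterate_mem_powDomain (theta_mem_powDomain hf.1) k) hσ fun n => ?_).trans
      (mul_le_mul_of_nonneg_left ih hσ.le)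
    rw [← Function.iterate_add_apply, ← Function.iterate_succ_apply]
    refine (hf.2 _).trans (le_of_eq ?_)
    rw [Nat.succ_eq_add_one]
    ring

theorem theta_eq_rieszBoas_one {f : X p} {σ : ℝ} (hσ : 0 < σ) (hf : f ∈ Bernstein p σ) :
    Theta p f = rieszBoas p 1 σ f :=
  theta_iterate_eq_rieszBoas hf.1 hσ hf.2 1 le_rfl

theorem theta_iterate_eq_rieszBoas_one_iterate {f : X p} {σ : ℝ} (hσ : 0 < σ)
    (hf : f ∈ Bernstein p σ) (r : ℕ) :
    (Theta p)^[r] f = (rieszBoas p 1 σ)^[r] f := by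
  induction r generalizing f with
  | zero => rfl
  | succ r ih =>
    rw [Function.iterate_succ_apply, Function.iterate_succ_apply, ih (theta_mem_bernstein hσ hf),
      theta_eq_rieszBoas_one hσ hf]

end Mellin

theorem mainTheorem10 (p : ℝ≥0∞) [Fact (1 ≤ p)] (hp₁ : 1 < p) (hp : p < ∞)
    (σ : ℝ) (hσ : 0 < σ) :
    (∀ r : ℕ, 1 ≤ r → ∀ g : Mellin.X p, Summable (Mellin.rieszBoasTerm p r σ g)) ∧
    (∀ f ∈ Mellin.Bernstein p σ,
      Mellin.rieszBoas p 1 σ f ∈ Mellin.Bernstein p σ ∧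
      Mellin.Theta p (Mellin.rieszBoas p 1 σ f) = Mellin.rieszBoas p 1 σ (Mellin.Theta p f)) ∧
    (∀ f ∈ Mellin.Bernstein p σ, ∀ r : ℕ, 1 ≤ r →
      (Mellin.Theta p)^[r] f = Mellin.rieszBoas p r σ f ∧
      Mellin.rieszBoas p r σ f = (Mellin.rieszBoas p 1 σ)^[r] f) := by
  refine ⟨fun r hr g => Mellin.summable_rieszBoasTerm r hr σ g, fun f hf => ?_,
    fun f hf r hr => ?_⟩
  -- `ℛ(σ)` agrees with `Θ` at both `f` and `Θ f`, so invariance and commutation reduce to `Θ f`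
  -- lying in the Bernstein space.
  · rw [← Mellin.theta_eq_rieszBoas_one hσ hf,
      ← Mellin.theta_eq_rieszBoas_one hσ (Mellin.theta_mem_bernstein hσ hf)]
    exact ⟨Mellin.theta_mem_bernstein hσ hf, rfl⟩
  · have h := Mellin.theta_iterate_eq_rieszBoas hf.1 hσ hf.2 r hr
    exact ⟨h, h ▸ Mellin.theta_iterate_eq_rieszBoas_one_iterate hσ hf r⟩
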